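/- Let $L$ be a countably infinite linear ordering that is scattered, i.e. the ordering of the rationals does not order-embed into $L$. Regard $L$ as a structure for the language with one binary relation symbol $\le$. Then $L$ has a $\Sigma_2$-generically c.e. copy, and $L$ has a $\Sigma_2$-coarsely c.e. copy. Here a *copy* of $L$ is a structure with universe $\mathbb{N}$ isomorphic to $L$, and the other notions are as follows, for an ordinal $\alpha$ and structures with universe $\mathbb N$. - A set $D\subseteq\mathbb{N}$ is *dense* if it has asymptotic density $1$, i.e. $\lim_{n\to\infty}\frac{|D\cap\{0,\dots,n\}|}{n+1}=1$. - $\Sigma_\alpha$ and $\Pi_\alpha$ formulas are those of $L_{\omega_1,\omega}$, with finitely many free variables: the $\Sigma_0$ and the $\Pi_0$ formulas are the finitary quantifier-free formulas; for $\alpha>0$, a $\Sigma_\alpha$ formula is a countable disjunction of formulas $\exists\bar y\,\psi$ with $\bar y$ a finite tuple and $\psi$ a $\Pi_\beta$ formula for some $\beta<\alpha$, and a $\Pi_\alpha$ formula is a countable conjunction of formulas $\forall\bar y\,\psi$ with $\psi$ a $\Sigma_\beta$ formula for some $\beta<\alpha$. - A substructure $\mathcal D$ of $\mathcal M$ is a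 *$\Sigma_\alpha$ elementary substructure* if $\mathcal D\models\varphi(\bar d)\iff\mathcal M\models\varphi(\bar d)$ for every $\Sigma_\alpha$ formula $\varphi$ and every tuple $\bar d$ from $\mathcal D$. - A substructure with universe $D\subseteq\mathbb N$ is a *c.e. substructure* if the set $D$ is c.e. and each relation, and the graph of each function, restricted to $D$ is c.e.; a structure with universe $\mathbb{N}$ is *c.e.* if this holds with $D=\mathbb{N}$. - $\mathcal M$ is *$\Sigma_\alpha$-generically c.e.* if there is a dense c.e. set $D$ such that the substructure of $\mathcal M$ with universe $D$ is a c.e. substructure and a $\Sigma_\alpha$ elementary substructure of $\mathcal M$. - $\mathcal M$ is *$\Sigma_\alpha$-coarsely c.e.* if there are a dense set $D$, a c.e. structure $\mathcal E$ with universe $\mathbb{N}$, and a structure $\mathcal D$ with universe $D$ such that $\mathcal D$ is a $\Sigma_\alpha$ elementary substructure of both $\mathcal M$ and $\mathcal E$. -/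

import Mathlib

open FirstOrder

/-- Infinitary formulas of `L_{ω₁,ω}` in the usual normal form, with free variables indexed by
`Fin n`. The basic formulas are the finitary quantifier-free formulas of `L`. From a sequence of
formulas `φ i` in the free variables `x̄` and a finite block `ȳ i` of `m i` further variables one
forms the countable disjunction `⋁ i, ∃ ȳ i, φ i (x̄, ȳ i)` and the countable conjunction
`⋀ i, ∀ ȳ i, φ i (x̄, ȳ i)`. (Blocks may be empty, and finite disjunctions and conjunctions are
obtained by repeating entries.) -/
inductive InfFormula (L : FirstOrder.Language.{0, 0}) : ℕ → Type
  | qf {n : ℕ} (φ : L.Formula (Fin n)) (hφ : φ.IsQF) : InfFormula L n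
  | disj {n : ℕ} (m : ℕ → ℕ) (φ : ∀ i, InfFormula L (n + m i)) : InfFormula L n
  | conj {n : ℕ} (m : ℕ → ℕ) (φ : ∀ i, InfFormula L (n + m i)) : InfFormula L n

namespace InfFormula

/-- Truth of an infinitary formula in the structure `M` on the set `X` at the tuple `v`. -/
def Realize {L : FirstOrder.Language.{0, 0}} {X : Type*} (M : L.Structure X) :
    {n : ℕ} → InfFormula L n → (Fin n → X) → Prop
  | _, qf φ _, v => φ.Realize v
  | _, disj m φ, v => ∃ i, ∃ w : Fin (m i) → X, Realize M (φ i) (Fin.append v w)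
  | _, conj m φ, v => ∀ i, ∀ w : Fin (m i) → X, Realize M (φ i) (Fin.append v w)

mutual

/-- `Σ_α` formulas: a `Σ_0` formula is a finitary quantifier-free formula; for `α > 0` a `Σ_α`
formula is a countable disjunction of formulas `∃ ȳ, ψ` where each `ψ` is `Π_β` for some
`β < α`. -/
inductive IsSigma {L : FirstOrder.Language.{0, 0}} : {n : ℕ} → Ordinal.{0} → InfFormula L n → Prop
  | qf {n : ℕ} (φ : L.Formula (Fin n)) (hφ : φ.IsQF) : IsSigma 0 (InfFormula.qf φ hφ)
  | disj {n : ℕ} {α : Ordinal.{0}} (hα : 0 < α) (m : ℕ → ℕ) (φ : ∀ i, InfFormula L (n + m i))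
      (β : ℕ → Ordinal.{0}) (hβ : ∀ i, β i < α) (hφ : ∀ i, IsPi (β i) (φ i)) :
      IsSigma α (InfFormula.disj m φ)

/-- `Π_α` formulas: a `Π_0` formula is a finitary quantifier-free formula; for `α > 0` a `Π_α`
formula is a countable conjunction of formulas `∀ ȳ, ψ` where each `ψ` is `Σ_β` for some
`β < α`. -/
inductive IsPi {L : FirstOrder.Language.{0, 0}} : {n : ℕ} → Ordinal.{0} → InfFormula L n → Prop
  | qf {n : ℕ} (φ : L.Formula (Fin n)) (hφ : φ.IsQF) : IsPi 0 (InfFormula.qf φ hφ)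
  | conj {n : ℕ} {α : Ordinal.{0}} (hα : 0 < α) (m : ℕ → ℕ) (φ : ∀ i, InfFormula L (n + m i))
      (β : ℕ → Ordinal.{0}) (hβ : ∀ i, β i < α) (hφ : ∀ i, IsSigma (β i) (φ i)) :
      IsPi α (InfFormula.conj m φ)

end

end InfFormula

/-- The structure `N`, whose universe is the subset `D` of `X`, is a `Σ_α` elementary
substructure of the structure `M` on `X`: it is a substructure (the inclusion respects function
symbols and, in both directions, relation symbols), and every `Σ_α` formula of `L_{ω₁,ω}` has the
same truth value in `N` and in `M` at every tuple from `D`. -/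
structure IsSigmaElementarySubstructure {L : FirstOrder.Language.{0, 0}} (α : Ordinal.{0}) {X : Type*}
    (M : L.Structure X) (D : Set X) (N : L.Structure D) : Prop where
  funMap_eq : ∀ {n : ℕ} (f : L.Functions n) (v : Fin n → D),
    (N.funMap f v : X) = M.funMap f (fun i => (v i : X))
  relMap_iff : ∀ {n : ℕ} (R : L.Relations n) (v : Fin n → D),
    N.RelMap R v ↔ M.RelMap R (fun i => (v i : X))
  realize_iff : ∀ {n : ℕ} (φ : InfFormula L n), φ.IsSigma α → ∀ v : Fin n → D,
    φ.Realize N v ↔ φ.Realize M (fun i => (v i : X))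

/-- A set of natural numbers is dense if it has asymptotic density `1`, that is, if
`|S ∩ {0, …, n}| / (n + 1)` tends to `1`. -/
def HasDensityOne (S : Set ℕ) : Prop :=
  Filter.Tendsto (fun n : ℕ => ((S ∩ Set.Iic n).ncard : ℝ) / ((n : ℝ) + 1))
    Filter.atTop (nhds 1)

/-- For a structure `M` on `ℕ` and a set `B ⊆ ℕ` (the universe of a substructure): `B` is c.e.,
and on `B` each relation is c.e. and each function has a c.e. graph. -/
structure IsCEOn {L : FirstOrder.Language.{0, 0}} (M : L.Structure ℕ) (B : Set ℕ) : Prop where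
  universe_ce : REPred (fun x : ℕ => x ∈ B)
  relMap_ce : ∀ {n : ℕ} (R : L.Relations n),
    REPred (fun v : Fin n → ℕ => (∀ i, v i ∈ B) ∧ M.RelMap R v)
  funMap_ce : ∀ {n : ℕ} (f : L.Functions n),
    REPred (fun p : (Fin n → ℕ) × ℕ => (∀ i, p.1 i ∈ B) ∧ M.funMap f p.1 = p.2)

/-- A structure on `ℕ` is c.e. if all its relations and the graphs of all its functions are. -/
def IsCEStructure {L : FirstOrder.Language.{0, 0}} (M : L.Structure ℕ) : Prop :=
  IsCEOn M Set.univ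

/-- `M` is `Σ_α`-generically c.e.: there is a dense c.e. set `D` which is the universe of a
c.e. substructure of `M` that is a `Σ_α` elementary substructure of `M`. -/
def IsSigmaGenericallyCE {L : FirstOrder.Language.{0, 0}} (α : Ordinal.{0}) (M : L.Structure ℕ) : Prop :=
  ∃ (D : Set ℕ) (N : L.Structure D), HasDensityOne D ∧ IsCEOn M D ∧
    IsSigmaElementarySubstructure α M D N

/-- `M` is `Σ_α`-coarsely c.e.: there are a dense set `D` and a c.e. structure `E` such that one
and the same structure with universe `D` is a `Σ_α` elementary substructure of both `M` and
`E`. -/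
def IsSigmaCoarselyCE {L : FirstOrder.Language.{0, 0}} (α : Ordinal.{0}) (M : L.Structure ℕ) : Prop :=
  ∃ (D : Set ℕ) (N : L.Structure D) (E : L.Structure ℕ), HasDensityOne D ∧ IsCEStructure E ∧
    IsSigmaElementarySubstructure α M D N ∧ IsSigmaElementarySubstructure α E D N

/-- The `L`-structure `S` on `A` has a `Σ_α`-generically c.e. copy, i.e. some structure with universe
`ℕ` isomorphic to `S` is `Σ_α`-generically c.e. -/
def HasSigmaGenericallyCECopy {L : FirstOrder.Language.{0, 0}} (α : Ordinal.{0}) {A : Type*}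
    (S : L.Structure A) : Prop :=
  ∃ M : L.Structure ℕ, Nonempty (A ≃[L] ℕ) ∧ IsSigmaGenericallyCE α M

/-- The `L`-structure `S` on `A` has a `Σ_α`-coarsely c.e. copy, i.e. some structure with universe
`ℕ` isomorphic to `S` is `Σ_α`-coarsely c.e. -/
def HasSigmaCoarselyCECopy {L : FirstOrder.Language.{0, 0}} (α : Ordinal.{0}) {A : Type*}
    (S : L.Structure A) : Prop :=
  ∃ M : L.Structure ℕ, Nonempty (A ≃[L] ℕ) ∧ IsSigmaCoarselyCE α M

/-- A linear order is scattered if the order of the rationals does not embed into it. -/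
def IsScattered (A : Type*) [LinearOrder A] : Prop :=
  IsEmpty (ℚ ↪o A)

/-- A linear order as a structure for the language with one binary relation symbol, interpreted
as `≤`. -/
abbrev linearOrderStructure (A : Type*) [LinearOrder A] :
    FirstOrder.Language.order.Structure A :=
  FirstOrder.Language.orderStructure A

/-!
A suborder `D` of a linear order `W` is a `Σ₂` elementary substructure as soon as `D` is scattered
and tame in `W`: it is a union of finite-distance classes of `W` (any two points of a class have
finitely many points between them), points consecutive in `D` are consecutive in `W`, and `D` and
`W` have the same endpoints. Indeed, given a finite tuple of `W`, its members in `D` stay where they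
are, and the others, which are infinitely far from all points of `D`, are moved into runs of
consecutive elements of `D`, which exist because `D` is scattered. After this move no cell of the
tuple has become larger, and that is what preserving `Π₁` formulas means for linear orders
(`IsTame.exists_retract`, `IsTame.exists_back`, `IsTame.isSigmaElementarySubstructure`).

Tameness leaves enough freedom to choose `D` computable. Let `X` and `Y` be the sets of points
with finitely many predecessors, respectively successors; they have type `n` or `ω`, respectively
`n` or `ω*`. If one of them is infinite, then `D = X + Y` is tame. Otherwise `D = X + M + Y` is tame
for every nonempty union `M` of finite-distance classes that has no endpoints and no new consecutive
points. Such an `M` can be taken of type `ζ`, `ω · ω*` or `ω* · ω`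
(`IsScattered.middlePart_trichotomy`): if there is neither a class of type `ζ`, nor a descending
sequence of classes of type `ω`, nor an ascending sequence of classes of type `ω*`, take the
last class of type `ω*` and the first class of type `ω` after it; scatteredness produces one more
infinite class between them, a contradiction. Then `D = P + Q` is also tame in a computable order
`P + R + Q` where `R` has exactly as many points as `W` has outside `D`
(`IsScattered.hasPrimrecSkeleton`). Enumerating this order computably, with `R` on
a sparse set of positions, yields the structures required for both notions
(`exists_computable_equiv`, `HasPrimrecSkeleton.hasCopies`).
-/

open Set

/-! ### Tame suborders and cells of finite families -/

/-- An order embedding preserves adjacency if it maps consecutive points to consecutive points and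
if its range contains every immediate neighbour of each of its points; in other words, the range is
a union of finite-distance classes, and consecutive points of the range are consecutive in the
whole order. -/
structure PreservesAdjacency {D W : Type*} [LinearOrder D] [LinearOrder W] (f : D ↪o W) : Prop where
  map_covBy : ∀ {a b}, a ⋖ b → f a ⋖ f b
  mem_range_of_covBy : ∀ {a x}, f a ⋖ x → x ∈ range f
  mem_range_of_covBy' : ∀ {a x}, x ⋖ f a → x ∈ range f

/-- An adjacency preserving embedding is tame if it also matches endpoints: domain and codomain
agree on whether there is a least (greatest) element, and on which element that is. -/
structure IsTame {D W : Type*} [LinearOrder D] [LinearOrder W] (f : D ↪o W) : Prop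
    extends PreservesAdjacency f where
  map_isMin : ∀ {a}, IsMin a → IsMin (f a)
  map_isMax : ∀ {a}, IsMax a → IsMax (f a)
  mem_range_of_isMin : ∀ {x}, IsMin x → x ∈ range f
  mem_range_of_isMax : ∀ {x}, IsMax x → x ∈ range f

/-- The cell of the points whose cut in the family `a` is `c`: those strictly above `a i` for
`i ∈ c` and strictly below `a i` for `i ∉ c`. -/
def cell {ι X : Type*} [LinearOrder X] (a : ι → X) (c : Set ι) : Set X :=
  {x | ∀ i, (i ∈ c → a i < x) ∧ (i ∉ c → x < a i)}

section Cells

variable {ι κ X Y D W : Type*} [LinearOrder X] [LinearOrder Y] [LinearOrder D] [LinearOrder W]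

theorem mem_cell_setOf {a : ι → X} {x : X} (hx : x ∉ range a) : x ∈ cell a {i | a i < x} :=
  fun i => ⟨id, fun h => lt_of_le_of_ne (not_lt.1 h) fun e => hx ⟨i, e.symm⟩⟩

theorem ordConnected_cell (a : ι → X) (c : Set ι) : (cell a c).OrdConnected :=
  ⟨fun _ hx _ hy _ hz i => ⟨fun h => ((hx i).1 h).trans_le hz.1,
    fun h => hz.2.trans_lt ((hy i).2 h)⟩⟩

theorem eq_of_mem_cell {a : ι → X} {c c' : Set ι} {x : X} (h : x ∈ cell a c) (h' : x ∈ cell a c') :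
    c = c' := by
  ext i
  by_cases hi : i ∈ c <;> by_cases hi' : i ∈ c' <;> simp only [hi, hi']
  · exact absurd ((h i).1 hi) ((h' i).2 hi').not_gt
  · exact absurd ((h' i).1 hi') ((h i).2 hi).not_gt

theorem notMem_range_of_mem_cell {a : ι → X} {c : Set ι} {x : X} (h : x ∈ cell a c) :
    x ∉ range a := by
  rintro ⟨i, rfl⟩
  by_cases hi : i ∈ c
  · exact ((h i).1 hi).false
  · exact ((h i).2 hi).false

theorem apply_mem_cell_iff (f : D ↪o W) (a : ι → D) (c : Set ι) (d : D) :
    f d ∈ cell (f ∘ a) c ↔ d ∈ cell a c := by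
  simp [cell]

/-- Strictly monotone maps on the cells of a family, into the corresponding cells of a family of
the same order type, glue to a strictly monotone map. -/
theorem exists_glue {a : ι → X} {b : ι → Y} (hab : ∀ i j, a i ≤ a j ↔ b i ≤ b j) (T : Set X)
    (g : Set ι → X → Y) (hg : ∀ c, StrictMonoOn (g c) (T ∩ cell a c))
    (hm : ∀ c, MapsTo (g c) (T ∩ cell a c) (cell b c)) :
    ∃ G : X → Y, (∀ i, G (a i) = b i) ∧ (∀ c, ∀ x ∈ cell a c, G x = g c x) ∧
      StrictMonoOn G (range a ∪ T) := by
  classical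
  have hlt : ∀ i j, a i < a j ↔ b i < b j := fun i j => by rw [lt_iff_not_ge, lt_iff_not_ge, hab]
  have hG1 : ∀ i (h : ∃ j, a j = a i), b h.choose = b i := fun i h =>
    le_antisymm ((hab _ _).1 h.choose_spec.le) ((hab _ _).1 h.choose_spec.ge)
  refine ⟨fun x => if h : ∃ i, a i = x then b h.choose else g {i | a i < x} x, ?_, ?_, ?_⟩
  · intro i
    have h : ∃ j, a j = a i := ⟨i, rfl⟩
    simp only [h, ↓reduceDIte, hG1 i h]
  · intro c x hx
    have h : ¬ ∃ i, a i = x := notMem_range_of_mem_cell hx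
    simp only [h, ↓reduceDIte]
    rw [eq_of_mem_cell hx (mem_cell_setOf h)]
  · intro x hx y hy hxy
    by_cases h1 : ∃ i, a i = x <;> by_cases h2 : ∃ i, a i = y
    · obtain ⟨i, rfl⟩ := h1
      obtain ⟨j, rfl⟩ := h2
      have h : ∃ k, a k = a i := ⟨i, rfl⟩
      have h' : ∃ k, a k = a j := ⟨j, rfl⟩
      simp only [h, h', ↓reduceDIte, hG1 i h, hG1 j h']
      exact (hlt i j).1 hxy
    · obtain ⟨i, rfl⟩ := h1
      have h : ∃ k, a k = a i := ⟨i, rfl⟩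
      simp only [h, h2, ↓reduceDIte, hG1 i h]
      have hyT : y ∈ T := hy.resolve_left h2
      exact (hm _ ⟨hyT, mem_cell_setOf h2⟩ i).1 hxy
    · obtain ⟨j, rfl⟩ := h2
      have h : ∃ k, a k = a j := ⟨j, rfl⟩
      simp only [h, h1, ↓reduceDIte, hG1 j h]
      have hxT : x ∈ T := hx.resolve_left h1
      exact (hm _ ⟨hxT, mem_cell_setOf h1⟩ j).2 hxy.not_gt
    · have hxT : x ∈ T := hx.resolve_left h1
      have hyT : y ∈ T := hy.resolve_left h2
      simp only [h1, h2, ↓reduceDIte]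
      by_cases h : ∃ i, x < a i ∧ a i < y
      · obtain ⟨i, hi, hi'⟩ := h
        exact ((hm _ ⟨hxT, mem_cell_setOf h1⟩ i).2 hi.not_gt).trans
          ((hm _ ⟨hyT, mem_cell_setOf h2⟩ i).1 hi')
      · have : {i | a i < x} = {i | a i < y} := by
          ext i
          refine ⟨fun hi => lt_trans hi hxy, fun hi => ?_⟩
          by_contra hi'
          exact h ⟨i, lt_of_le_of_ne (not_lt.1 hi') fun e => h1 ⟨i, e.symm⟩, hi⟩
        rw [this]
        exact hg _ ⟨hxT, this ▸ mem_cell_setOf h1⟩ ⟨hyT, mem_cell_setOf h2⟩ hxy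

theorem exists_strictMonoOn_of_card_eq [Nonempty Y] (U : Finset X) (V : Finset Y)
    (h : V.card = U.card) : ∃ g : X → Y, StrictMonoOn g U ∧ MapsTo g U V := by
  classical
  refine ⟨fun x => if hx : x ∈ U then V.orderEmbOfFin h ((U.orderIsoOfFin rfl).symm ⟨x, hx⟩)
    else Classical.arbitrary Y, ?_, ?_⟩
  · intro x hx y hy hxy
    simp only [Finset.mem_coe] at hx hy
    simp only [hx, hy, ↓reduceDIte]
    exact (V.orderEmbOfFin h).strictMono ((U.orderIsoOfFin rfl).symm.strictMono hxy)
  · intro x hx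
    simp only [Finset.mem_coe] at hx
    simp only [hx, ↓reduceDIte]
    exact Finset.orderEmbOfFin_mem _ _ _

/-- If two families have the same order type, and each cell of the first has at most as many
points as the corresponding cell of the second, then every finite set of points on the first side
can be matched on the second side. -/
theorem exists_strictMonoOn_of_encard_cell_le [Nonempty Y] {a : ι → X} {b : ι → Y}
    (hab : ∀ i j, a i ≤ a j ↔ b i ≤ b j)
    (hc : ∀ c, (cell a c).Nonempty → (cell a c).encard ≤ (cell b c).encard)
    {T : Set X} (hT : T.Finite) :
    ∃ G : X → Y, (∀ i, G (a i) = b i) ∧ StrictMonoOn G (range a ∪ T) := by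
  have h1 : ∀ c, ∃ g : X → Y, StrictMonoOn g (T ∩ cell a c) ∧
      MapsTo g (T ∩ cell a c) (cell b c) := by
    intro c
    have hfin : (T ∩ cell a c).Finite := hT.inter_of_left _
    rcases (cell a c).eq_empty_or_nonempty with he | he
    · simp [he, StrictMonoOn, MapsTo]
    have hle : (T ∩ cell a c).encard ≤ (cell b c).encard :=
      (encard_le_encard inter_subset_right).trans (hc c he)
    obtain ⟨V, hV, hVc⟩ := exists_subset_encard_eq hle
    have hVf : V.Finite := by
      rw [← encard_ne_top_iff, hVc]; exact encard_ne_top_iff.2 hfin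
    obtain ⟨g, hg, hgm⟩ := exists_strictMonoOn_of_card_eq hfin.toFinset hVf.toFinset (by
      rw [hVf.encard_eq_coe_toFinset_card, hfin.encard_eq_coe_toFinset_card] at hVc
      exact_mod_cast hVc)
    simp only [Finite.coe_toFinset] at hg hgm
    exact ⟨g, hg, hgm.mono_right hV⟩
  choose g hg hm using h1
  obtain ⟨G, hG, -, hG'⟩ := exists_glue hab T g hg hm
  exact ⟨G, hG, hG'⟩

variable {f : D ↪o W}

/-- A finite cell of a tame suborder gains no points in the whole order. -/
theorem IsTame.mem_image_of_finite_cell (hf : IsTame f) [Nonempty D] [Finite ι] {a : ι → D}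
    {c : Set ι} (h : (cell a c).Finite) {x : W} (hx : x ∈ cell (f ∘ a) c) : x ∈ range f := by
  by_contra hxr
  set T : Set D := cell a c ∪ range a with hTdef
  have hT : T.Finite := h.union (finite_range a)
  -- a point of `D` between two elements of `T` that enclose `x` lies in the cell
  have hmem : ∀ d, (∀ t ∈ T, f t < x → t < d) → (∀ t ∈ T, x < f t → d < t) → d ∈ cell a c := by
    intro d h1 h2 i
    exact ⟨fun hi => h1 _ (Or.inr ⟨i, rfl⟩) ((hx i).1 hi),
      fun hi => h2 _ (Or.inr ⟨i, rfl⟩) ((hx i).2 hi)⟩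
  have hne : ∀ t, f t ≠ x := fun t e => hxr ⟨t, e⟩
  have hA : (∃ t ∈ T, f t < x) → ∃ t ∈ T, f t < x ∧ ∀ s ∈ T, f s < x → s ≤ t := by
    rintro ⟨t, ht, htx⟩
    obtain ⟨m, hm, hmax⟩ := (hT.subset (sep_subset T fun s => f s < x)).exists_maximal ⟨t, ht, htx⟩
    exact ⟨m, hm.1, hm.2, fun s hs hsx => (le_total s m).elim id fun h => hmax ⟨hs, hsx⟩ h⟩
  have hB : (∃ t ∈ T, x < f t) → ∃ t ∈ T, x < f t ∧ ∀ s ∈ T, x < f s → t ≤ s := by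
    rintro ⟨t, ht, htx⟩
    obtain ⟨m, hm, hmin⟩ := (hT.subset (sep_subset T fun s => x < f s)).exists_minimal ⟨t, ht, htx⟩
    exact ⟨m, hm.1, hm.2, fun s hs hsx => (le_total m s).elim id fun h => hmin ⟨hs, hsx⟩ h⟩
  by_cases h1 : ∃ t ∈ T, f t < x <;> by_cases h2 : ∃ t ∈ T, x < f t
  · obtain ⟨t, ht, htx, htm⟩ := hA h1
    obtain ⟨s, hs, hsx, hsm⟩ := hB h2
    have hcov : t ⋖ s := by
      refine ⟨f.lt_iff_lt.1 (htx.trans hsx), fun d hd hd' => ?_⟩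
      have hdT : d ∈ T := Or.inl (hmem d (fun u hu hux => (htm u hu hux).trans_lt hd)
        (fun u hu hux => hd'.trans_le (hsm u hu hux)))
      rcases lt_or_gt_of_ne (hne d) with hd2 | hd2
      · exact (htm d hdT hd2).not_gt hd
      · exact (hsm d hdT hd2).not_gt hd'
    exact (hf.map_covBy hcov).2 htx hsx
  · obtain ⟨t, ht, htx, htm⟩ := hA h1
    have hmax : IsMax t := by
      intro d hd
      by_contra hd'
      rw [not_le] at hd'
      have hdT : d ∈ T := Or.inl (hmem d (fun u hu hux => (htm u hu hux).trans_lt hd')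
        (fun u hu hux => (h2 ⟨u, hu, hux⟩).elim))
      rcases lt_or_gt_of_ne (hne d) with hd2 | hd2
      · exact (htm d hdT hd2).not_gt hd'
      · exact h2 ⟨d, hdT, hd2⟩
    exact (hf.map_isMax hmax).not_lt htx
  · obtain ⟨t, ht, htx, htm⟩ := hB h2
    have hmin : IsMin t := by
      intro d hd
      by_contra hd'
      rw [not_le] at hd'
      have hdT : d ∈ T := Or.inl (hmem d (fun u hu hux => (h1 ⟨u, hu, hux⟩).elim)
        (fun u hu hux => hd'.trans_le (htm u hu hux)))
      rcases lt_or_gt_of_ne (hne d) with hd2 | hd2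
      · exact h1 ⟨d, hdT, hd2⟩
      · exact (htm d hdT hd2).not_gt hd'
    exact (hf.map_isMin hmin).not_lt htx
  · obtain ⟨d⟩ := ‹Nonempty D›
    have hdT : d ∈ T := Or.inl (hmem d (fun u hu hux => (h1 ⟨u, hu, hux⟩).elim)
        (fun u hu hux => (h2 ⟨u, hu, hux⟩).elim))
    rcases lt_or_gt_of_ne (hne d) with hd2 | hd2
    · exact h1 ⟨d, hdT, hd2⟩
    · exact h2 ⟨d, hdT, hd2⟩

theorem IsTame.encard_cell_le (hf : IsTame f) [Nonempty D] [Finite ι] (a : ι → D)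
    (c : Set ι) : (cell (f ∘ a) c).encard ≤ (cell a c).encard := by
  by_cases h : (cell a c).Finite
  · rw [← f.injective.encard_image (cell a c)]
    refine encard_le_encard fun x hx => ?_
    obtain ⟨d, rfl⟩ := hf.mem_image_of_finite_cell h hx
    exact ⟨d, (apply_mem_cell_iff f a c d).1 hx, rfl⟩
  · rw [Set.Infinite.encard_eq h]; exact le_top

theorem exists_covBy_of_finite_Ioo {x y : X} (hxy : x < y) (h : (Ioo x y).Finite) :
    ∃ z, x ≤ z ∧ z ⋖ y := by
  rcases (Ioo x y).eq_empty_or_nonempty with he | he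
  · exact ⟨x, le_rfl, hxy, fun z h1 h2 => (he ▸ (⟨h1, h2⟩ : z ∈ Ioo x y) : z ∈ (∅ : Set X))⟩
  · obtain ⟨m, hm, hmax⟩ := h.exists_maximal he
    refine ⟨m, hm.1.le, hm.2, fun z h1 h2 => ?_⟩
    exact (hmax (⟨hm.1.trans h1, h2⟩ : z ∈ Ioo x y) h1.le).not_gt h1

theorem exists_covBy_of_finite_Ioo' {x y : X} (hxy : x < y) (h : (Ioo x y).Finite) :
    ∃ z, z ≤ y ∧ x ⋖ z := by
  rcases (Ioo x y).eq_empty_or_nonempty with he | he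
  · exact ⟨y, le_rfl, hxy, fun z h1 h2 => (he ▸ (⟨h1, h2⟩ : z ∈ Ioo x y) : z ∈ (∅ : Set X))⟩
  · obtain ⟨m, hm, hmin⟩ := h.exists_minimal he
    refine ⟨m, hm.2.le, hm.1, fun z h1 h2 => ?_⟩
    exact (hmin (⟨h1, h2.trans hm.2⟩ : z ∈ Ioo x y) h2.le).not_gt h2

theorem PreservesAdjacency.mem_range_of_finite_Ioo (hf : PreservesAdjacency f) {x : W} {d : D}
    (hx : x < f d) (h : (Ioo x (f d)).Finite) : x ∈ range f := by
  induction hn : (Ioo x (f d)).ncard using Nat.strong_induction_on generalizing d with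
  | _ n ih =>
    obtain ⟨z, hxz, hz⟩ := exists_covBy_of_finite_Ioo hx h
    obtain ⟨e, rfl⟩ := hf.mem_range_of_covBy' hz
    rcases hxz.eq_or_lt with rfl | hxz
    · exact ⟨e, rfl⟩
    have hss : Ioo x (f e) ⊂ Ioo x (f d) :=
      ⟨Ioo_subset_Ioo_right hz.le, fun hs => (hs ⟨hxz, hz.lt⟩).2.false⟩
    exact ih _ (hn ▸ ncard_lt_ncard hss h) hxz (h.subset hss.1) rfl

theorem PreservesAdjacency.mem_range_of_finite_Ioo' (hf : PreservesAdjacency f) {x : W} {d : D}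
    (hx : f d < x) (h : (Ioo (f d) x).Finite) : x ∈ range f := by
  induction hn : (Ioo (f d) x).ncard using Nat.strong_induction_on generalizing d with
  | _ n ih =>
    obtain ⟨z, hxz, hz⟩ := exists_covBy_of_finite_Ioo' hx h
    obtain ⟨e, rfl⟩ := hf.mem_range_of_covBy hz
    rcases hxz.eq_or_lt with rfl | hxz
    · exact ⟨e, rfl⟩
    have hss : Ioo (f e) x ⊂ Ioo (f d) x :=
      ⟨Ioo_subset_Ioo_left hz.le, fun hs => (hs ⟨hz.lt, hxz⟩).1.false⟩
    exact ih _ (hn ▸ ncard_lt_ncard hss h) hxz (h.subset hss.1) rfl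

theorem IsTame.mem_range_of_finite_Ioi (hf : IsTame f) {x : W} (h : (Ioi x).Finite) :
    x ∈ range f := by
  rcases (Ioi x).eq_empty_or_nonempty with he | he
  · exact hf.mem_range_of_isMax (isMax_iff_forall_not_lt.2 fun y hy =>
      (he ▸ (hy : y ∈ Ioi x) : y ∈ (∅ : Set W)))
  · obtain ⟨m, hm, hmax⟩ := h.exists_maximal he
    obtain ⟨d, rfl⟩ := hf.mem_range_of_isMax (x := m) fun y hy => hmax (lt_of_lt_of_le hm hy) hy
    exact hf.mem_range_of_finite_Ioo hm (h.subset Ioo_subset_Ioi_self)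

theorem IsTame.mem_range_of_finite_Iio (hf : IsTame f) {x : W} (h : (Iio x).Finite) :
    x ∈ range f := by
  rcases (Iio x).eq_empty_or_nonempty with he | he
  · exact hf.mem_range_of_isMin (isMin_iff_forall_not_lt.2 fun y hy =>
      (he ▸ (hy : y ∈ Iio x) : y ∈ (∅ : Set W)))
  · obtain ⟨m, hm, hmin⟩ := h.exists_minimal he
    obtain ⟨d, rfl⟩ := hf.mem_range_of_isMin (x := m) fun y hy => hmin (lt_of_le_of_lt hy hm) hy
    exact hf.mem_range_of_finite_Ioo' hm (h.subset Ioo_subset_Iio_self)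

/-- Between a point outside a tame suborder and the next member of a finite family from the
suborder (or the end of the order) there are infinitely many points. -/
theorem IsTame.infinite_cell_inter_Ioi (hf : IsTame f) [Finite ι] {a : ι → D} {c : Set ι} {x : W}
    (hx : x ∈ cell (f ∘ a) c) (hxr : x ∉ range f) : (cell (f ∘ a) c ∩ Ioi x).Infinite := by
  intro hfin
  by_cases hc : ∃ i, i ∉ c
  · obtain ⟨i, hi, hmin⟩ := (Set.toFinite (f ∘ a '' cᶜ)).exists_minimal (by
      obtain ⟨i, hi⟩ := hc; exact ⟨_, i, hi, rfl⟩)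
    obtain ⟨i, hi, rfl⟩ := hi
    refine hxr (hf.mem_range_of_finite_Ioo ((hx i).2 hi)
      (hfin.subset fun y hy => ⟨fun j => ?_, hy.1⟩))
    refine ⟨fun hj => ((hx j).1 hj).trans hy.1, fun hj => hy.2.trans_le ?_⟩
    exact (le_total (f (a i)) (f (a j))).elim id fun h => hmin ⟨j, hj, rfl⟩ h
  · push Not at hc
    exact hxr (hf.mem_range_of_finite_Ioi (hfin.subset fun y hy =>
      ⟨fun j => ⟨fun hj => ((hx j).1 hj).trans hy, fun hj => (hj (hc j)).elim⟩, hy⟩))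

theorem IsTame.infinite_cell_inter_Iio (hf : IsTame f) [Finite ι] {a : ι → D} {c : Set ι} {x : W}
    (hx : x ∈ cell (f ∘ a) c) (hxr : x ∉ range f) : (cell (f ∘ a) c ∩ Iio x).Infinite := by
  intro hfin
  by_cases hc : ∃ i, i ∈ c
  · obtain ⟨i, hi, hmax⟩ := (Set.toFinite (f ∘ a '' c)).exists_maximal (by
      obtain ⟨i, hi⟩ := hc; exact ⟨_, i, hi, rfl⟩)
    obtain ⟨i, hi, rfl⟩ := hi
    refine hxr (hf.mem_range_of_finite_Ioo' ((hx i).1 hi)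
      (hfin.subset fun y hy => ⟨fun j => ?_, hy.2⟩))
    refine ⟨fun hj => lt_of_le_of_lt ?_ hy.1, fun hj => hy.2.trans ((hx j).2 hj)⟩
    exact (le_total (f (a j)) (f (a i))).elim id fun h => hmax ⟨j, hj, rfl⟩ h
  · push Not at hc
    exact hxr (hf.mem_range_of_finite_Iio (hfin.subset fun y hy =>
      ⟨fun j => ⟨fun hj => (hc j hj).elim, fun hj => lt_trans hy ((hx j).2 hj)⟩, hy⟩))

end Cells

/-- Every infinite convex set contains arbitrarily long finite runs of consecutive elements. -/
def HasLongRuns (D : Type*) [LinearOrder D] : Prop :=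
  ∀ I : Set D, I.OrdConnected → I.Infinite → ∀ n : ℕ, ∃ R : Finset D,
    (R : Set D) ⊆ I ∧ R.card = n ∧ (R : Set D).OrdConnected

/-! ### Moving finite tuples into a tame suborder -/

section BackAndForth

variable {ι κ D W : Type*} [LinearOrder D] [LinearOrder W] {f : D ↪o W}

/-- Any finite set of points can be moved into a tame suborder, fixing finitely many points of
the suborder. -/
theorem IsTame.exists_retract (hf : IsTame f) [Nonempty D] [Finite ι] (a : ι → D) {T : Set W}
    (hT : T.Finite) : ∃ G : W → D, (∀ i, G (f (a i)) = a i) ∧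
      StrictMonoOn G (range (f ∘ a) ∪ T) :=
  exists_strictMonoOn_of_encard_cell_le (a := f ∘ a) (b := a) (fun i j => by simp)
    (fun c _ => hf.encard_cell_le a c) hT

/-- The combinatorial core of `Σ₂`-elementarity. Let `b` be a finite family in `W`, whose members
in `f '' D` are listed by `a`, and let `G` move `b` into `D`, fixing `a` and sending the members
of `b` in each cell of `a` onto a run of consecutive elements of `D`. Then a cell of `G ∘ b` is
contained in the corresponding cell of `b` unless the latter is infinite. -/
theorem IsTame.infinite_cell_of_notMem (hf : IsTame f) [Finite ι] [Finite κ] {a : ι → D} {b : κ → W}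
    (hab : ∀ k, b k ∈ range f → b k ∈ range (f ∘ a)) {G : W → D} (hGa : ∀ i, G (f (a i)) = a i)
    (hG : StrictMonoOn G (range (f ∘ a) ∪ range b))
    (hrun : ∀ c, (G '' (range b ∩ cell (f ∘ a) c)).OrdConnected)
    {C : Set κ} {x : D} (hx : x ∈ cell (G ∘ b) C) (hx' : f x ∉ cell b C) :
    (cell b C).Infinite := by
  have hfa : ∀ k i, f (a i) < b k ↔ a i < G (b k) := fun k i => by
    have := hG.lt_iff_lt (Or.inl ⟨i, rfl⟩ : f (a i) ∈ _) (Or.inr ⟨k, rfl⟩ : b k ∈ _)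
    rwa [hGa, Iff.comm] at this
  have haf : ∀ k i, b k < f (a i) ↔ G (b k) < a i := fun k i => by
    have := hG.lt_iff_lt (Or.inr ⟨k, rfl⟩ : b k ∈ _) (Or.inl ⟨i, rfl⟩ : f (a i) ∈ _)
    rwa [hGa, Iff.comm] at this
  have hxC : ∀ {k}, G (b k) < x → k ∈ C := fun {k} h => by
    by_contra hk; exact ((hx k).2 hk).not_gt h
  have hxC' : ∀ {k}, x < G (b k) → k ∉ C := fun {k} h hk => ((hx k).1 hk).not_gt h
  -- a point of `b` outside a cell of `a` is separated from that cell by a member of `a`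
  have hsep : ∀ {c : Set ι} {k}, b k ∉ cell (f ∘ a) c →
      (∃ i ∈ c, b k ≤ f (a i)) ∨ ∃ i ∉ c, f (a i) ≤ b k := by
    intro c k h
    simp only [cell, mem_ofPred_eq, not_forall, not_and_or, not_lt] at h
    obtain ⟨i, h | h⟩ := h
    · exact Or.inl ⟨i, h.1, h.2⟩
    · exact Or.inr ⟨i, h.1, h.2⟩
  have hle : ∀ k i, b k ≤ f (a i) ↔ G (b k) ≤ a i := fun k i => by
    rw [← not_lt, hfa, not_lt]
  have hge : ∀ k i, f (a i) ≤ b k ↔ a i ≤ G (b k) := fun k i => by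
    rw [← not_lt, haf, not_lt]
  simp only [cell, mem_ofPred_eq, not_forall, not_and_or, not_lt] at hx'
  obtain ⟨k, ⟨hk, hxk⟩ | ⟨hk, hxk⟩⟩ := hx'
  · have hkr : b k ∉ range f := by
      intro h
      obtain ⟨i, hi⟩ := hab k h
      have hi' : f (a i) = b k := hi
      have : a i < x := by simpa [← hi', hGa] using (hx k).1 hk
      exact (f.lt_iff_lt.2 this).not_ge (hi' ▸ hxk)
    have hkx : G (b k) < x := (hx k).1 hk
    have hxk : f x < b k := hxk.lt_of_ne fun e => hkr ⟨x, e⟩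
    set c : Set ι := {i | (f ∘ a) i < b k} with hc
    have hkc : b k ∈ cell (f ∘ a) c := mem_cell_setOf fun ⟨i, hi⟩ => hkr ⟨a i, hi⟩
    have hxc : x ∈ cell a c := fun i =>
      ⟨fun hi => ((hfa k i).1 ((hkc i).1 hi)).trans hkx,
        fun hi => f.lt_iff_lt.1 (hxk.trans ((hkc i).2 hi))⟩
    -- the run avoids `x` and starts below it, so it stays below it
    have hbelow : ∀ l, b l ∈ cell (f ∘ a) c → l ∈ C := by
      intro l hl
      by_contra hlC
      have := (hrun c).out ⟨b k, ⟨⟨k, rfl⟩, hkc⟩, rfl⟩ ⟨b l, ⟨⟨l, rfl⟩, hl⟩, rfl⟩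
        ⟨hkx.le, ((hx l).2 hlC).le⟩
      obtain ⟨_, ⟨⟨j, rfl⟩, -⟩, hj⟩ := this
      exact notMem_range_of_mem_cell hx ⟨j, hj⟩
    obtain ⟨m, ⟨⟨l, rfl⟩, hlc⟩, hmax⟩ :=
      ((finite_range b).inter_of_left (cell (f ∘ a) c)).exists_maximal ⟨b k, ⟨k, rfl⟩, hkc⟩
    have hlr : b l ∉ range f := fun h => notMem_range_of_mem_cell hlc (hab l h)
    refine (hf.infinite_cell_inter_Ioi hlc hlr).mono fun y hy j => ?_
    by_cases hjc : b j ∈ cell (f ∘ a) c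
    · refine ⟨fun _ => lt_of_le_of_lt ?_ hy.2, fun h => (h (hbelow j hjc)).elim⟩
      exact (le_total (b j) (b l)).elim id fun h => hmax ⟨⟨j, rfl⟩, hjc⟩ h
    · obtain ⟨i, hi, hij⟩ | ⟨i, hi, hij⟩ := hsep hjc
      · exact ⟨fun _ => hij.trans_lt ((hy.1 i).1 hi),
          fun h => (h (hxC (((hle j i).1 hij).trans_lt ((hxc i).1 hi)))).elim⟩
      · exact ⟨fun h => (hxC' (((hxc i).2 hi).trans_le ((hge j i).1 hij)) h).elim,
          fun _ => ((hy.1 i).2 hi).trans_le hij⟩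
  · have hkr : b k ∉ range f := by
      intro h
      obtain ⟨i, hi⟩ := hab k h
      have hi' : f (a i) = b k := hi
      have : x < a i := by simpa [← hi', hGa] using (hx k).2 hk
      exact (f.lt_iff_lt.2 this).not_ge (hi' ▸ hxk)
    have hkx : x < G (b k) := (hx k).2 hk
    have hxk : b k < f x := hxk.lt_of_ne fun e => hkr ⟨x, e.symm⟩
    set c : Set ι := {i | (f ∘ a) i < b k} with hc
    have hkc : b k ∈ cell (f ∘ a) c := mem_cell_setOf fun ⟨i, hi⟩ => hkr ⟨a i, hi⟩
    have hxc : x ∈ cell a c := fun i =>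
      ⟨fun hi => f.lt_iff_lt.1 (((hkc i).1 hi).trans hxk),
        fun hi => hkx.trans ((haf k i).1 ((hkc i).2 hi))⟩
    have habove : ∀ l, b l ∈ cell (f ∘ a) c → l ∉ C := by
      intro l hl hlC
      have := (hrun c).out ⟨b l, ⟨⟨l, rfl⟩, hl⟩, rfl⟩ ⟨b k, ⟨⟨k, rfl⟩, hkc⟩, rfl⟩
        ⟨((hx l).1 hlC).le, hkx.le⟩
      obtain ⟨_, ⟨⟨j, rfl⟩, -⟩, hj⟩ := this
      exact notMem_range_of_mem_cell hx ⟨j, hj⟩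
    obtain ⟨m, ⟨⟨l, rfl⟩, hlc⟩, hmin⟩ :=
      ((finite_range b).inter_of_left (cell (f ∘ a) c)).exists_minimal ⟨b k, ⟨k, rfl⟩, hkc⟩
    have hlr : b l ∉ range f := fun h => notMem_range_of_mem_cell hlc (hab l h)
    refine (hf.infinite_cell_inter_Iio hlc hlr).mono fun y hy j => ?_
    by_cases hjc : b j ∈ cell (f ∘ a) c
    · refine ⟨fun h => (habove j hjc h).elim, fun _ => lt_of_lt_of_le hy.2 ?_⟩
      exact (le_total (b l) (b j)).elim id fun h => hmin ⟨⟨j, rfl⟩, hjc⟩ h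
    · obtain ⟨i, hi, hij⟩ | ⟨i, hi, hij⟩ := hsep hjc
      · exact ⟨fun _ => hij.trans_lt ((hy.1 i).1 hi),
          fun h => (h (hxC (((hle j i).1 hij).trans_lt ((hxc i).1 hi)))).elim⟩
      · exact ⟨fun h => (hxC' (((hxc i).2 hi).trans_le ((hge j i).1 hij)) h).elim,
          fun _ => ((hy.1 i).2 hi).trans_le hij⟩

/-- Every finite family of points can be moved into a tame suborder, fixing its members that are
already there, so that every finite configuration of points of the suborder around the image is
realized around the original family. -/
theorem IsTame.exists_back (hf : IsTame f) (hD : HasLongRuns D) [Nonempty D] [Finite κ]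
    (b : κ → W) :
    ∃ G : W → D, StrictMonoOn G (range b) ∧ (∀ d, f d ∈ range b → G (f d) = d) ∧
      ∀ T : Set D, T.Finite →
        ∃ H : D → W, (∀ k, H (G (b k)) = b k) ∧ StrictMonoOn H (range (G ∘ b) ∪ T) := by
  classical
  have hS : (f ⁻¹' range b).Finite := (finite_range b).preimage f.injective.injOn
  have := hS.to_subtype
  set a : ↥(f ⁻¹' range b) → D := Subtype.val with ha
  have hab : ∀ k, b k ∈ range f → b k ∈ range (f ∘ a) := by
    rintro k ⟨d, hd⟩
    exact ⟨⟨d, k, hd.symm⟩, hd⟩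
  have hU : ∀ c : Set _, (range b ∩ cell (f ∘ a) c).Finite := fun c =>
    (finite_range b).inter_of_left _
  have h1 : ∀ c : Set _, ∃ g : W → D, StrictMonoOn g (range b ∩ cell (f ∘ a) c) ∧
      MapsTo g (range b ∩ cell (f ∘ a) c) (cell a c) ∧
      (g '' (range b ∩ cell (f ∘ a) c)).OrdConnected := by
    intro c
    rcases (range b ∩ cell (f ∘ a) c).eq_empty_or_nonempty with he | ⟨_, ⟨k, rfl⟩, hk⟩
    · obtain ⟨d⟩ := ‹Nonempty D›
      exact ⟨fun _ => d, by simp [he, StrictMonoOn, MapsTo, ordConnected_empty]⟩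
    have hinf : (cell a c).Infinite := fun hfin =>
      notMem_range_of_mem_cell hk (hab k (hf.mem_image_of_finite_cell hfin hk))
    obtain ⟨R, hR, hcard, hconv⟩ := hD _ (ordConnected_cell a c) hinf (hU c).toFinset.card
    obtain ⟨g, hg, hgm⟩ := exists_strictMonoOn_of_card_eq (hU c).toFinset R hcard
    have himg := Finset.surjOn_of_injOn_of_card_le g hgm hg.injOn hcard.le
    simp only [Finite.coe_toFinset] at hg hgm himg
    refine ⟨g, hg, hgm.mono_right hR, ?_⟩
    rw [(himg.image_eq_of_mapsTo hgm)]
    exact hconv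
  choose g hg hgm hgr using h1
  obtain ⟨G, hGa, hGc, hG⟩ := exists_glue (a := f ∘ a) (b := a) (fun i j => by simp)
    (range b) g hg hgm
  have hrun : ∀ c, (G '' (range b ∩ cell (f ∘ a) c)).OrdConnected := fun c => by
    rw [image_congr fun x hx => hGc c x hx.2]; exact hgr c
  refine ⟨G, hG.mono subset_union_right, fun d hd => hGa ⟨d, hd⟩, fun T hT => ?_⟩
  have hord := hG.mono (subset_union_right (s := range (f ∘ a)))
  have : Nonempty W := ‹Nonempty D›.map f
  refine exists_strictMonoOn_of_encard_cell_le (a := G ∘ b) (b := b)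
    (fun i j => hord.le_iff_le ⟨i, rfl⟩ ⟨j, rfl⟩) (fun C _ => ?_) hT
  by_cases hinf : (cell b C).Infinite
  · rw [hinf.encard_eq]; exact le_top
  · rw [← f.injective.encard_image]
    refine encard_le_encard ?_
    rintro _ ⟨x, hx, rfl⟩
    by_contra hx'
    exact hinf (hf.infinite_cell_of_notMem hab hGa hG hrun hx hx')

end BackAndForth

/-! ### Runs of consecutive elements in scattered orders -/

section Scattered

variable {D : Type*} [LinearOrder D]

theorem IsScattered.of_embedding {W : Type*} [LinearOrder W] (h : IsScattered W) (f : D ↪o W) :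
    IsScattered D :=
  ⟨fun g => h.false (g.trans f)⟩

/-- In a scattered order, an infinite convex set has a point with infinitely many points of the
set at finite distance: otherwise the least elements of the finite-distance classes
would form a dense order. -/
theorem IsScattered.exists_infinite_class (h : IsScattered D) {I : Set D} (hI : I.OrdConnected)
    (hinf : I.Infinite) : ∃ x ∈ I, {y ∈ I | (uIcc x y).Finite}.Infinite := by
  by_contra hcon
  simp only [not_exists, not_and, not_infinite] at hcon
  set T : Set D := {x ∈ I | ∀ y ∈ I, y < x → (Icc y x).Infinite} with hT
  have hrep : ∀ x ∈ I, ∃ t ∈ T, t ≤ x ∧ (Icc t x).Finite := by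
    intro x hx
    obtain ⟨t, ⟨ht, htx⟩, hmin⟩ := (hcon x hx).exists_minimal ⟨x, hx, by simp⟩
    have hle : t ≤ x := (le_total t x).elim id fun h => hmin ⟨hx, by simp⟩ h
    rw [uIcc_of_ge hle] at htx
    refine ⟨t, ⟨ht, fun y hy hyt hfin => ?_⟩, hle, htx⟩
    refine (hmin ⟨hy, ?_⟩ hyt.le).not_gt hyt
    rw [uIcc_of_ge (hyt.le.trans hle), ← Icc_union_Icc_eq_Icc hyt.le hle]
    exact hfin.union htx
  have hdense : ∀ x ∈ T, ∀ z ∈ I, x ≤ z → ¬ (uIcc x z).Finite → ∃ t ∈ T, x < t ∧ t ≤ z := by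
    intro x hx z hz hxz hfin
    obtain ⟨t, ht, htz, htf⟩ := hrep z hz
    refine ⟨t, ht, not_le.1 fun htx => hfin ?_, htz⟩
    rw [uIcc_of_le hxz]
    exact htf.subset (Icc_subset_Icc_left htx)
  have hlt : ∀ x ∈ T, ∀ y ∈ T, x < y → (Icc x y).Infinite := fun x hx y hy hxy => hy.2 x hx.1 hxy
  have hd : DenselyOrdered T := by
    refine ⟨fun x y hxy => ?_⟩
    have hsub : Icc (x : D) y ⊆ I := hI.out x.2.1 y.2.1
    obtain ⟨z, hz, hz'⟩ := ((hlt x x.2 y y.2 hxy).sdiff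
      ((hcon x x.2.1).union (hcon y y.2.1))).nonempty
    have hzI := hsub hz
    simp only [mem_union, mem_ofPred_eq, hzI, true_and, not_or] at hz'
    obtain ⟨t, ht, hxt, htz⟩ := hdense x x.2 z hzI hz.1 hz'.1
    refine ⟨⟨t, ht⟩, hxt, show t < (y : D) from lt_of_le_of_lt htz (lt_of_le_of_ne hz.2 ?_)⟩
    rintro rfl
    exact hz'.2 (by simp)
  have hnt : Nontrivial T := by
    obtain ⟨x, hx⟩ := hinf.nonempty
    obtain ⟨t, ht, -, -⟩ := hrep x hx
    obtain ⟨z, hz, hz'⟩ := (hinf.sdiff (hcon t ht.1)).nonempty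
    simp only [mem_ofPred_eq, hz, true_and] at hz'
    obtain ⟨s, hs, hsz, hsf⟩ := hrep z hz
    refine ⟨⟨t, ht⟩, ⟨s, hs⟩, fun e => hz' ?_⟩
    obtain rfl : t = s := congrArg Subtype.val e
    rwa [uIcc_of_le hsz]
  obtain ⟨e⟩ := Order.embedding_from_countable_to_dense ℚ T
  exact h.false (e.trans (OrderEmbedding.subtype _))

theorem exists_subset_ordConnected_card_eq (R : Finset D) (hR : (R : Set D).OrdConnected) {n : ℕ}
    (hn : n ≤ R.card) : ∃ R' ⊆ R, R'.card = n ∧ (R' : Set D).OrdConnected := by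
  induction hk : R.card - n generalizing R with
  | zero => exact ⟨R, subset_rfl, by omega, hR⟩
  | succ k ih =>
    have hne : R.Nonempty := Finset.card_pos.1 (by omega)
    have hcard := Finset.card_erase_of_mem (R.max'_mem hne)
    obtain ⟨R', hR', h⟩ := ih (R.erase (R.max' hne)) ⟨fun x hx y hy z hz => by
      simp only [Finset.coe_erase, mem_sdiff, Finset.mem_coe, mem_singleton_iff] at hx hy ⊢
      refine ⟨hR.out hx.1 hy.1 hz, ?_⟩
      exact (hz.2.trans_lt ((R.le_max' y hy.1).lt_of_ne hy.2)).ne⟩ (by omega) (by omega)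
    exact ⟨R', hR'.trans (Finset.erase_subset _ _), h⟩

/-- Scattered orders contain arbitrarily long runs in every infinite convex set: a class of the
finite-distance relation that is infinite within the set provides them. -/
theorem IsScattered.hasLongRuns (h : IsScattered D) : HasLongRuns D := by
  intro I hI hinf n
  obtain ⟨x, hx, hxinf⟩ := h.exists_infinite_class hI hinf
  obtain ⟨V, hV, hVc⟩ := hxinf.exists_subset_card_eq (n + 1)
  -- the convex hull of finitely many points at finite distance from `x` is finite
  have hVne : V.Nonempty := Finset.card_pos.1 (by omega)
  have hfin : (Icc (V.min' hVne) (V.max' hVne)).Finite := by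
    refine ((hV (V.min'_mem hVne)).2.union (hV (V.max'_mem hVne)).2).subset ?_
    intro y hy
    rcases le_total y x with hyx | hyx
    · exact Or.inl (Icc_subset_uIcc' ⟨hy.1, hyx⟩)
    · exact Or.inr (Icc_subset_uIcc ⟨hyx, hy.2⟩)
  obtain ⟨R, hR, hRc, hRo⟩ := exists_subset_ordConnected_card_eq hfin.toFinset
    (by simpa using ordConnected_Icc) (n := n) (by
      have := Finset.card_le_card (show V ⊆ hfin.toFinset from fun y hy => by
        simpa using ⟨V.min'_le y hy, V.le_max' y hy⟩)
      omega)
  refine ⟨R, fun y hy => ?_, hRc, hRo⟩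
  have := hR hy
  simp only [Finite.mem_toFinset] at this
  exact hI.out (hV (V.min'_mem hVne)).1 (hV (V.max'_mem hVne)).1 this

end Scattered

/-! ### Embeddings of sums and products -/

section Constructions

variable {ι β P Q R W : Type*} [LinearOrder ι] [LinearOrder β] [LinearOrder P] [LinearOrder Q]
  [LinearOrder R] [LinearOrder W]

/-- Two order embeddings, the first lying entirely below the second, as an embedding of the ordered
sum. -/
def sumEmbedding (p : P ↪o W) (q : Q ↪o W) (h : ∀ a b, p a < q b) : P ⊕ₗ Q ↪o W :=
  OrderEmbedding.ofMapLEIff (fun s => Sum.elim p q (ofLex s)) <| by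
    intro s t
    induction s using Lex.rec with | _ s
    induction t using Lex.rec with | _ t
    rcases s with a | b <;> rcases t with a' | b'
    · simp
    · simpa using (h a b').le
    · simpa using h a' b
    · simp

theorem range_sumEmbedding (p : P ↪o W) (q : Q ↪o W) (h : ∀ a b, p a < q b) :
    range (sumEmbedding p q h) = range p ∪ range q := by
  rw [← Sum.elim_range]
  exact (toLex : P ⊕ Q ≃ _).surjective.range_comp _ |>.symm

/-- Order embeddings indexed by a linear order, each lying below the later ones, as an embedding of
the lexicographic product. -/
def prodEmbedding (g : ι → β ↪o W) (h : ∀ i j, i < j → ∀ x y, g i x < g j y) : ι ×ₗ β ↪o W :=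
  OrderEmbedding.ofStrictMono (fun s => g (ofLex s).1 (ofLex s).2) <| by
    intro s t hst
    rcases Prod.Lex.lt_iff.1 hst with h1 | ⟨h1, h2⟩
    · exact h _ _ h1 _ _
    · beta_reduce
      rw [h1]
      exact (g _).strictMono h2

/-- An order embedding into the order dual, read as an embedding of the order dual. -/
def dualEmbedding (p : P ↪o Wᵒᵈ) : Pᵒᵈ ↪o W :=
  OrderEmbedding.ofMapLEIff (fun a => OrderDual.ofDual (p (OrderDual.ofDual a))) fun a b => by
    simp

theorem range_dualEmbedding (p : P ↪o Wᵒᵈ) :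
    range (dualEmbedding p) = OrderDual.toDual ⁻¹' range p := rfl

theorem PreservesAdjacency.dualEmbedding {p : P ↪o Wᵒᵈ} (hp : PreservesAdjacency p) :
    PreservesAdjacency (dualEmbedding p) where
  map_covBy {a b} h := by
    have h' : OrderDual.ofDual b ⋖ OrderDual.ofDual a := ofDual_covBy_ofDual_iff.2 h
    exact ofDual_covBy_ofDual_iff.2 (hp.map_covBy h')
  mem_range_of_covBy {a x} h := by
    have h' : OrderDual.toDual x ⋖ p (OrderDual.ofDual a) :=
      (ofDual_covBy_ofDual_iff (a := p (OrderDual.ofDual a)) (b := OrderDual.toDual x)).1 h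
    exact hp.mem_range_of_covBy' h'
  mem_range_of_covBy' {a x} h := by
    have h' : p (OrderDual.ofDual a) ⋖ OrderDual.toDual x :=
      (ofDual_covBy_ofDual_iff (b := p (OrderDual.ofDual a)) (a := OrderDual.toDual x)).1 h
    exact hp.mem_range_of_covBy h'

theorem isMax_and_isMin_of_inl_covBy_inr {a : P} {b : Q}
    (h : (toLex (Sum.inl a) : P ⊕ₗ Q) ⋖ toLex (Sum.inr b)) : IsMax a ∧ IsMin b := by
  constructor
  · exact isMax_iff_forall_not_lt.2 fun c hc =>
      h.2 (Sum.Lex.inl_lt_inl_iff.2 hc) (Sum.Lex.inl_lt_inr _ _)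
  · exact isMin_iff_forall_not_lt.2 fun c hc =>
      h.2 (Sum.Lex.inl_lt_inr _ _) (Sum.Lex.inr_lt_inr_iff.2 hc)

theorem covBy_of_inl_covBy_inl {a b : P}
    (h : (toLex (Sum.inl a) : P ⊕ₗ Q) ⋖ toLex (Sum.inl b)) : a ⋖ b :=
  ⟨Sum.Lex.inl_lt_inl_iff.1 h.1, fun _ h1 h2 =>
    h.2 (Sum.Lex.inl_lt_inl_iff.2 h1) (Sum.Lex.inl_lt_inl_iff.2 h2)⟩

theorem covBy_of_inr_covBy_inr {a b : Q}
    (h : (toLex (Sum.inr a) : P ⊕ₗ Q) ⋖ toLex (Sum.inr b)) : a ⋖ b :=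
  ⟨Sum.Lex.inr_lt_inr_iff.1 h.1, fun _ h1 h2 =>
    h.2 (Sum.Lex.inr_lt_inr_iff.2 h1) (Sum.Lex.inr_lt_inr_iff.2 h2)⟩

/-- Adjacency preserving embeddings, one below the other, combine as long as the sum has no new
pair of consecutive points. -/
theorem PreservesAdjacency.sum {p : P ↪o W} {q : Q ↪o W} (hp : PreservesAdjacency p)
    (hq : PreservesAdjacency q) (h : ∀ a b, p a < q b) (hPQ : NoMaxOrder P ∨ NoMinOrder Q) :
    PreservesAdjacency (sumEmbedding p q h) where
  map_covBy {s t} hst := by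
    induction s using Lex.rec with | _ s
    induction t using Lex.rec with | _ t
    rcases s with a | b <;> rcases t with a' | b'
    · exact hp.map_covBy (covBy_of_inl_covBy_inl hst)
    · obtain ⟨h1, h2⟩ := isMax_and_isMin_of_inl_covBy_inr hst
      rcases hPQ with hP | hQ
      · exact (not_isMax a h1).elim
      · exact (not_isMin b' h2).elim
    · exact (Sum.Lex.not_inr_lt_inl hst.1).elim
    · exact hq.map_covBy (covBy_of_inr_covBy_inr hst)
  mem_range_of_covBy {s x} hx := by
    rw [range_sumEmbedding]
    induction s using Lex.rec with | _ s
    rcases s with a | b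
    exacts [Or.inl (hp.mem_range_of_covBy hx), Or.inr (hq.mem_range_of_covBy hx)]
  mem_range_of_covBy' {s x} hx := by
    rw [range_sumEmbedding]
    induction s using Lex.rec with | _ s
    rcases s with a | b
    exacts [Or.inl (hp.mem_range_of_covBy' hx), Or.inr (hq.mem_range_of_covBy' hx)]

theorem PreservesAdjacency.prod [NoMaxOrder β] {g : ι → β ↪o W}
    (hg : ∀ i, PreservesAdjacency (g i)) (h : ∀ i j, i < j → ∀ x y, g i x < g j y) :
    PreservesAdjacency (prodEmbedding g h) where
  map_covBy {s t} hst := by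
    rcases Prod.Lex.lt_iff.1 hst.1 with h1 | ⟨h1, h2⟩
    · obtain ⟨y, hy⟩ := exists_gt (ofLex s).2
      exact (hst.2 (c := toLex ((ofLex s).1, y)) (Prod.Lex.lt_iff.2 (Or.inr ⟨rfl, hy⟩))
        (Prod.Lex.lt_iff.2 (Or.inl h1))).elim
    · have : (ofLex s).2 ⋖ (ofLex t).2 := ⟨h2, fun y h3 h4 =>
        hst.2 (c := toLex ((ofLex s).1, y)) (Prod.Lex.lt_iff.2 (Or.inr ⟨rfl, h3⟩))
          (Prod.Lex.lt_iff.2 (Or.inr ⟨h1, h4⟩))⟩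
      show g (ofLex s).1 (ofLex s).2 ⋖ g (ofLex t).1 (ofLex t).2
      rw [h1]
      exact (hg _).map_covBy this
  mem_range_of_covBy {s x} hx := by
    obtain ⟨y, rfl⟩ := (hg _).mem_range_of_covBy hx
    exact ⟨toLex (_, y), rfl⟩
  mem_range_of_covBy' {s x} hx := by
    obtain ⟨y, rfl⟩ := (hg _).mem_range_of_covBy' hx
    exact ⟨toLex (_, y), rfl⟩

/-- A sum of an initial segment and a final part is tame when the endpoints match and the sum has
no new pair of consecutive points. -/
theorem PreservesAdjacency.isTame_sum {p : P ↪o W} {q : Q ↪o W} (hp : PreservesAdjacency p)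
    (hq : PreservesAdjacency q) (h : ∀ a b, p a < q b)
    (hPQ : NoMaxOrder P ∧ Nonempty P ∨ NoMinOrder Q ∧ Nonempty Q)
    (hp1 : IsLowerSet (range p)) (hp2 : ∀ x, IsMin x → x ∈ range p ∪ range q)
    (hq1 : ∀ b, IsMax b → IsMax (q b)) (hq2 : ∀ x, IsMax x → x ∈ range p ∪ range q) :
    IsTame (sumEmbedding p q h) where
  toPreservesAdjacency := hp.sum hq h (hPQ.imp And.left And.left)
  map_isMin {s} hs := by
    induction s using Lex.rec with | _ s
    rcases s with a | b
    · intro x hx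
      obtain ⟨a', rfl⟩ := hp1 hx ⟨a, rfl⟩
      have : toLex (Sum.inl a) ≤ (toLex (Sum.inl a') : P ⊕ₗ Q) :=
        hs (Sum.Lex.inl_le_inl_iff.2 (p.le_iff_le.1 hx))
      exact p.le_iff_le.2 (Sum.Lex.inl_le_inl_iff.1 this)
    · rcases hPQ with ⟨-, ⟨a⟩⟩ | ⟨hQ, -⟩
      · exact (Sum.Lex.not_inr_le_inl (hs (Sum.Lex.inl_le_inr a b))).elim
      · obtain ⟨c, hc⟩ := exists_lt b
        have : toLex (Sum.inr b) ≤ (toLex (Sum.inr c) : P ⊕ₗ Q) :=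
          hs (Sum.Lex.inr_le_inr_iff.2 hc.le)
        exact ((Sum.Lex.inr_le_inr_iff.1 this).not_gt hc).elim
  map_isMax {s} hs := by
    induction s using Lex.rec with | _ s
    rcases s with a | b
    · rcases hPQ with ⟨hP, -⟩ | ⟨-, ⟨b⟩⟩
      · obtain ⟨c, hc⟩ := exists_gt a
        have : toLex (Sum.inl c) ≤ (toLex (Sum.inl a) : P ⊕ₗ Q) :=
          hs (Sum.Lex.inl_le_inl_iff.2 hc.le)
        exact ((Sum.Lex.inl_le_inl_iff.1 this).not_gt hc).elim
      · exact (Sum.Lex.not_inr_le_inl (hs (Sum.Lex.inl_le_inr a b))).elim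
    · exact hq1 b fun c hc => Sum.Lex.inr_le_inr_iff.1 (hs (Sum.Lex.inr_le_inr_iff.2 hc))
  mem_range_of_isMin {x} hx := by rw [range_sumEmbedding]; exact hp2 x hx
  mem_range_of_isMax {x} hx := by rw [range_sumEmbedding]; exact hq2 x hx

/-- The embedding of `P + Q` into `P + R + Q`. -/
def insertEmbedding (P R Q : Type*) [LinearOrder P] [LinearOrder R] [LinearOrder Q] :
    P ⊕ₗ Q ↪o P ⊕ₗ (R ⊕ₗ Q) :=
  sumEmbedding (OrderEmbedding.ofStrictMono _ Sum.Lex.inl_strictMono)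
    (OrderEmbedding.ofStrictMono _ (Sum.Lex.inr_strictMono.comp Sum.Lex.inr_strictMono))
    fun a _ => Sum.Lex.inl_lt_inr a _

theorem mem_range_insertEmbedding_or (x : P ⊕ₗ (R ⊕ₗ Q)) :
    x ∈ range (insertEmbedding P R Q) ∨ ∃ z, x = toLex (Sum.inr (toLex (Sum.inl z))) := by
  induction x using Lex.rec with | _ x
  rcases x with a | x
  · exact Or.inl ⟨toLex (Sum.inl a), rfl⟩
  · induction x using Lex.rec with | _ x
    rcases x with z | b
    exacts [Or.inr ⟨z, rfl⟩, Or.inl ⟨toLex (Sum.inr b), rfl⟩]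

theorem isTame_insertEmbedding (h1 : NoMaxOrder P ∨ NoMinOrder R) (h2 : NoMaxOrder R ∨ NoMinOrder Q)
    (hPQ : NoMaxOrder P ∧ Nonempty P ∨ NoMinOrder Q ∧ Nonempty Q)
    (hR : Nonempty P ∨ NoMinOrder R) (hR' : Nonempty Q ∨ NoMaxOrder R) :
    IsTame (insertEmbedding P R Q) := by
  have hmid : ∀ x : P ⊕ₗ (R ⊕ₗ Q), x ∈ range (insertEmbedding P R Q) ∨
      ∃ z, x = toLex (Sum.inr (toLex (Sum.inl z))) := mem_range_insertEmbedding_or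
  have hPR : ∀ (a : P) (z : R),
      ¬ (toLex (Sum.inl a) : P ⊕ₗ (R ⊕ₗ Q)) ⋖ toLex (Sum.inr (toLex (Sum.inl z))) := by
    intro a z h
    obtain ⟨ha, hz⟩ := isMax_and_isMin_of_inl_covBy_inr h
    rcases h1 with h1 | h1
    · exact not_isMax a ha
    · exact not_isMin z fun w hw => Sum.Lex.inl_le_inl_iff.1 (hz (Sum.Lex.inl_le_inl_iff.2 hw))
  have hRQ : ∀ (z : R) (b : Q), ¬ (toLex (Sum.inr (toLex (Sum.inl z))) : P ⊕ₗ (R ⊕ₗ Q)) ⋖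
      toLex (Sum.inr (toLex (Sum.inr b))) := by
    intro z b h
    obtain ⟨hz, hb⟩ := isMax_and_isMin_of_inl_covBy_inr (covBy_of_inr_covBy_inr h)
    rcases h2 with h2 | h2
    exacts [not_isMax z hz, not_isMin b hb]
  have hPQ' : ∀ (a : P) (b : Q), ¬ (toLex (Sum.inl a) : P ⊕ₗ (R ⊕ₗ Q)) ⋖
      toLex (Sum.inr (toLex (Sum.inr b))) := by
    intro a b h
    obtain ⟨ha, hb⟩ := isMax_and_isMin_of_inl_covBy_inr h
    rcases hPQ with ⟨h, -⟩ | ⟨h, -⟩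
    · exact not_isMax a ha
    · exact not_isMin b fun w hw => Sum.Lex.inr_le_inr_iff.1 (hb (Sum.Lex.inr_le_inr_iff.2 hw))
  refine PreservesAdjacency.isTame_sum ⟨?_, ?_, ?_⟩ ⟨?_, ?_, ?_⟩ _ hPQ ?_ ?_ ?_ ?_
  · rintro a b hab
    refine ⟨Sum.Lex.inl_lt_inl_iff.2 hab.1, fun x hx hx' => ?_⟩
    induction x using Lex.rec with | _ x
    rcases x with c | x
    · exact hab.2 (Sum.Lex.inl_lt_inl_iff.1 hx) (Sum.Lex.inl_lt_inl_iff.1 hx')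
    · exact Sum.Lex.not_inr_lt_inl hx'
  · intro a x hx
    induction x using Lex.rec with | _ x
    rcases x with c | x
    · exact ⟨c, rfl⟩
    · induction x using Lex.rec with | _ x
      rcases x with z | b
      exacts [(hPR a z hx).elim, (hPQ' a b hx).elim]
  · intro a x hx
    induction x using Lex.rec with | _ x
    rcases x with c | x
    · exact ⟨c, rfl⟩
    · exact (Sum.Lex.not_inr_lt_inl hx.1).elim
  · rintro a b hab
    refine ⟨Sum.Lex.inr_lt_inr_iff.2 (Sum.Lex.inr_lt_inr_iff.2 hab.1), fun x hx hx' => ?_⟩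
    induction x using Lex.rec with | _ x
    rcases x with c | x
    · exact Sum.Lex.not_inr_lt_inl hx
    · induction x using Lex.rec with | _ x
      have hx := Sum.Lex.inr_lt_inr_iff.1 hx
      have hx' := Sum.Lex.inr_lt_inr_iff.1 hx'
      rcases x with z | c
      · exact Sum.Lex.not_inr_lt_inl hx
      · exact hab.2 (Sum.Lex.inr_lt_inr_iff.1 hx) (Sum.Lex.inr_lt_inr_iff.1 hx')
  · intro b x hx
    induction x using Lex.rec with | _ x
    rcases x with c | x
    · exact (Sum.Lex.not_inr_lt_inl hx.1).elim
    · induction x using Lex.rec with | _ x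
      rcases x with z | c
      · exact (Sum.Lex.not_inr_lt_inl (Sum.Lex.inr_lt_inr_iff.1 hx.1)).elim
      · exact ⟨c, rfl⟩
  · intro b x hx
    induction x using Lex.rec with | _ x
    rcases x with a | x
    · exact (hPQ' a b hx).elim
    · induction x using Lex.rec with | _ x
      rcases x with z | c
      exacts [(hRQ z b hx).elim, ⟨c, rfl⟩]
  · rintro x y hyx ⟨a, rfl⟩
    induction y using Lex.rec with | _ y
    rcases y with c | y
    · exact ⟨c, rfl⟩
    · exact (Sum.Lex.not_inr_le_inl hyx).elim
  · intro x hx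
    rw [← range_sumEmbedding]
    rcases hmid x with h | ⟨z, rfl⟩
    · exact h
    · rcases hR with ⟨⟨a⟩⟩ | hR
      · exact (Sum.Lex.not_inr_le_inl (hx (Sum.Lex.inl_le_inr a _))).elim
      · obtain ⟨w, hw⟩ := exists_lt z
        have := hx (b := toLex (Sum.inr (toLex (Sum.inl w))))
          (Sum.Lex.inr_le_inr_iff.2 (Sum.Lex.inl_le_inl_iff.2 hw.le))
        exact ((Sum.Lex.inl_le_inl_iff.1 (Sum.Lex.inr_le_inr_iff.1 this)).not_gt hw).elim
  · intro _ hb x hx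
    induction x using Lex.rec with | _ x
    rcases x with a | x
    · exact Sum.Lex.inl_le_inr _ _
    · induction x using Lex.rec with | _ x
      rcases x with z | c
      · exact Sum.Lex.inr_le_inr_iff.2 (Sum.Lex.inl_le_inr _ _)
      · exact Sum.Lex.inr_le_inr_iff.2 (Sum.Lex.inr_le_inr_iff.2
          (hb (Sum.Lex.inr_le_inr_iff.1 (Sum.Lex.inr_le_inr_iff.1 hx))))
  · intro x hx
    rw [← range_sumEmbedding]
    rcases hmid x with h | ⟨z, rfl⟩
    · exact h
    · rcases hR' with ⟨⟨b⟩⟩ | hR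
      · have := hx (b := toLex (Sum.inr (toLex (Sum.inr b))))
          (Sum.Lex.inr_le_inr_iff.2 (Sum.Lex.inl_le_inr _ _))
        exact (Sum.Lex.not_inr_le_inl (Sum.Lex.inr_le_inr_iff.1 this)).elim
      · obtain ⟨w, hw⟩ := exists_gt z
        have := hx (b := toLex (Sum.inr (toLex (Sum.inl w))))
          (Sum.Lex.inr_le_inr_iff.2 (Sum.Lex.inl_le_inl_iff.2 hw.le))
        exact ((Sum.Lex.inl_le_inl_iff.1 (Sum.Lex.inr_le_inr_iff.1 this)).not_gt hw).elim

end Constructions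

/-! ### Primitive recursive linear orders -/

section PrimrecOrders

/-- A linear order that has a presentation with primitive recursive universe and relation. -/
def IsPrimrecOrder (P : Type) [LinearOrder P] : Prop :=
  ∃ _ : Primcodable P, PrimrecRel fun a b : P => a ≤ b

instance Lex.primcodable {P : Type*} [Primcodable P] : Primcodable (Lex P) :=
  inferInstanceAs (Primcodable P)

instance OrderDual.primcodable {P : Type*} [Primcodable P] : Primcodable Pᵒᵈ :=
  inferInstanceAs (Primcodable P)

theorem Primrec.ofLex {P : Type*} [Primcodable P] : Primrec (ofLex : Lex P → P) :=
  Primrec.id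

theorem isPrimrecOrder_nat : IsPrimrecOrder ℕ :=
  ⟨inferInstance, Primrec.nat_le⟩

theorem isPrimrecOrder_fin (n : ℕ) : IsPrimrecOrder (Fin n) :=
  ⟨inferInstance, Primrec.nat_le.comp₂ (Primrec.fin_val.comp Primrec.fst)
    (Primrec.fin_val.comp Primrec.snd)⟩

theorem IsPrimrecOrder.dual {P : Type} [LinearOrder P] (h : IsPrimrecOrder P) :
    IsPrimrecOrder Pᵒᵈ := by
  obtain ⟨hP, h⟩ := h
  exact ⟨inferInstance, PrimrecPred.comp (p := fun x : P × P => x.1 ≤ x.2) h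
    (Primrec.pair (Primrec.snd (α := P) (β := P)) Primrec.fst)⟩

theorem primrecRel_le_sumLex {P Q : Type*} [LinearOrder P] [LinearOrder Q] [Primcodable P]
    [Primcodable Q] (hP : PrimrecRel fun a b : P => a ≤ b) (hQ : PrimrecRel fun a b : Q => a ≤ b) :
    PrimrecRel fun a b : P ⊕ₗ Q => a ≤ b := by
  classical
  refine ⟨inferInstance, ?_⟩
  have h : Primrec fun x : (P ⊕ₗ Q) × (P ⊕ₗ Q) => (Sum.casesOn (ofLex x.1)
      (fun a => Sum.casesOn (ofLex x.2) (fun a' => decide (a ≤ a')) fun _ => true)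
      (fun b => Sum.casesOn (ofLex x.2) (fun _ => false) fun b' => decide (b ≤ b')) : Bool) := by
    refine Primrec.sumCasesOn (Primrec.ofLex.comp Primrec.fst) ?_ ?_
    · refine Primrec.sumCasesOn (Primrec.ofLex.comp (Primrec.snd.comp Primrec.fst)) ?_
        (Primrec₂.const true)
      exact (PrimrecPred.comp (p := fun x : P × P => x.1 ≤ x.2) hP
        (Primrec.pair (Primrec.snd.comp Primrec.fst) Primrec.snd)).decide
    · refine Primrec.sumCasesOn (Primrec.ofLex.comp (Primrec.snd.comp Primrec.fst))
        (Primrec₂.const false) ?_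
      exact (PrimrecPred.comp (p := fun x : Q × Q => x.1 ≤ x.2) hQ
        (Primrec.pair (Primrec.snd.comp Primrec.fst) Primrec.snd)).decide
  refine h.of_eq fun ⟨s, t⟩ => ?_
  induction s using Lex.rec with | _ s
  induction t using Lex.rec with | _ t
  rcases s with a | b <;> rcases t with a' | b' <;> simp

theorem IsPrimrecOrder.sumLex {P Q : Type} [LinearOrder P] [LinearOrder Q]
    (hP : IsPrimrecOrder P) (hQ : IsPrimrecOrder Q) : IsPrimrecOrder (P ⊕ₗ Q) := by
  obtain ⟨_, hP⟩ := hP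
  obtain ⟨_, hQ⟩ := hQ
  exact ⟨inferInstance, primrecRel_le_sumLex hP hQ⟩

theorem isPrimrecOrder_zeta : IsPrimrecOrder (ℕᵒᵈ ⊕ₗ ℕ) :=
  isPrimrecOrder_nat.dual.sumLex isPrimrecOrder_nat

theorem IsPrimrecOrder.prodLex {P Q : Type} [LinearOrder P] [LinearOrder Q]
    (hP : IsPrimrecOrder P) (hQ : IsPrimrecOrder Q) : IsPrimrecOrder (P ×ₗ Q) := by
  obtain ⟨_, hP⟩ := hP
  obtain ⟨_, hQ⟩ := hQ
  have h1 : PrimrecPred fun x : (P ×ₗ Q) × (P ×ₗ Q) => (ofLex x.1).1 ≤ (ofLex x.2).1 :=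
    PrimrecPred.comp (p := fun x : P × P => x.1 ≤ x.2) hP (Primrec.pair
      (Primrec.fst.comp (Primrec.ofLex.comp Primrec.fst))
      (Primrec.fst.comp (Primrec.ofLex.comp Primrec.snd)))
  have h2 : PrimrecPred fun x : (P ×ₗ Q) × (P ×ₗ Q) => (ofLex x.2).1 ≤ (ofLex x.1).1 :=
    PrimrecPred.comp (p := fun x : P × P => x.1 ≤ x.2) hP (Primrec.pair
      (Primrec.fst.comp (Primrec.ofLex.comp Primrec.snd))
      (Primrec.fst.comp (Primrec.ofLex.comp Primrec.fst)))
  have h3 : PrimrecPred fun x : (P ×ₗ Q) × (P ×ₗ Q) => (ofLex x.1).2 ≤ (ofLex x.2).2 :=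
    PrimrecPred.comp (p := fun x : Q × Q => x.1 ≤ x.2) hQ (Primrec.pair
      (Primrec.snd.comp (Primrec.ofLex.comp Primrec.fst))
      (Primrec.snd.comp (Primrec.ofLex.comp Primrec.snd)))
  refine ⟨inferInstance, (h2.not.or (h1.and (h2.and h3))).of_eq fun ⟨s, t⟩ => ?_⟩
  change _ ↔ s ≤ t
  rw [Prod.Lex.le_iff, not_le]
  refine or_congr_right ⟨fun h => ⟨le_antisymm h.1 h.2.1, h.2.2⟩, fun h => ⟨h.1.le, h.1.ge, h.2⟩⟩

end PrimrecOrders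

/-! ### Finite-distance classes -/

section Chains

variable {W : Type*} [LinearOrder W]

/-- There are successors of `x` of every finite order. For the order dual this says that there are
predecessors of every finite order. -/
def HasSuccChain (x : W) : Prop :=
  ∃ g : ℕ → W, g 0 = x ∧ ∀ n, g n ⋖ g (n + 1)

/-- A point that has successors of every finite order, but no immediate predecessor: the least
element of a finite-distance class of type `ω`. For the order dual this describes the greatest
element of a class of type `ω*`. -/
def IsOmegaStart (x : W) : Prop :=
  HasSuccChain x ∧ ∀ y, ¬ y ⋖ x

/-- A set that contains all immediate neighbours of its points. -/
def IsCovClosed (I : Set W) : Prop :=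
  ∀ x ∈ I, ∀ y, (x ⋖ y ∨ y ⋖ x) → y ∈ I

theorem IsCovClosed.inter {I J : Set W} (hI : IsCovClosed I) (hJ : IsCovClosed J) :
    IsCovClosed (I ∩ J) :=
  fun x hx y hy => ⟨hI x hx.1 y hy, hJ x hx.2 y hy⟩

theorem IsCovClosed.dual {I : Set W} (hI : IsCovClosed I) :
    IsCovClosed (OrderDual.ofDual ⁻¹' I) := fun _ hx _ hy =>
  hI _ hx _ (hy.symm.imp (fun h => ofDual_covBy_ofDual_iff.2 h)
    fun h => ofDual_covBy_ofDual_iff.2 h)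

theorem isCovClosed_Iio {t : W} (ht : ∀ y, ¬ y ⋖ t) : IsCovClosed (Iio t) := by
  rintro x hx y (h | h)
  · refine lt_of_le_of_ne (not_lt.1 fun hy => h.2 hx hy) ?_
    rintro rfl
    exact ht _ h
  · exact h.lt.trans hx

theorem isCovClosed_Ioi {s : W} (hs : ∀ y, ¬ s ⋖ y) : IsCovClosed (Ioi s) := by
  rintro x hx y (h | h)
  · exact lt_trans hx h.lt
  · refine lt_of_le_of_ne (not_lt.1 fun hy => h.2 hy hx) ?_
    rintro rfl
    exact hs _ h

theorem mem_range_of_chain {g : ℕ → W} (hg : ∀ n, g n ⋖ g (n + 1)) {b : W} (h0 : g 0 ≤ b) {k : ℕ}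
    (hk : b ≤ g k) : b ∈ range g := by
  induction k with
  | zero => exact ⟨0, le_antisymm h0 hk⟩
  | succ k ih =>
    rcases le_or_gt b (g k) with h | h
    · exact ih h
    · exact ⟨k + 1, (hk.eq_of_not_lt fun h' => (hg k).2 h h').symm⟩

theorem strictMono_of_chain {g : ℕ → W} (hg : ∀ n, g n ⋖ g (n + 1)) : StrictMono g :=
  strictMono_nat_of_lt_succ fun n => (hg n).lt

/-- If infinitely many points lie at finite distance above `x`, then `x` has successors of every
finite order. -/
theorem hasSuccChain_of_infinite {x : W} (h : {y | x ≤ y ∧ (Icc x y).Finite}.Infinite) :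
    HasSuccChain x := by
  set S := {y | x ≤ y ∧ (Icc x y).Finite} with hS
  have hnext : ∀ z : S, ∃ z' : S, (z : W) ⋖ z' := by
    rintro ⟨z, hxz, hz⟩
    obtain ⟨y, ⟨hxy, hy⟩, hyz⟩ := (h.sdiff hz).nonempty
    have hzy : z < y := not_le.1 fun h => hyz ⟨hxy, h⟩
    obtain ⟨w, hwy, hzw⟩ := exists_covBy_of_finite_Ioo' hzy
      (hy.subset fun u hu => ⟨hxz.trans hu.1.le, hu.2.le⟩)
    exact ⟨⟨w, hxz.trans hzw.le, hy.subset (Icc_subset_Icc_right hwy)⟩, hzw⟩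
  choose s hs using hnext
  let g : ℕ → S := fun n => s^[n] ⟨x, le_rfl, by simp⟩
  refine ⟨fun n => g n, rfl, fun n => ?_⟩
  simp only [g, Function.iterate_succ_apply']
  exact hs _

theorem HasSuccChain.of_covBy {x y : W} (h : HasSuccChain x) (hy : y ⋖ x) : HasSuccChain y := by
  obtain ⟨g, rfl, hg⟩ := h
  exact ⟨fun n => Nat.casesOn n y g, rfl, fun n => by cases n <;> simp [hy, hg]⟩

/-- Going down from a point with a successor chain, one either never stops or arrives at the least
element of a finite-distance class. -/
theorem HasSuccChain.exists_start {I : Set W} (hI : IsCovClosed I) {x : W} (hx : x ∈ I)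
    (h : HasSuccChain x) : HasSuccChain (OrderDual.toDual x) ∨ ∃ t ∈ I, IsOmegaStart t := by
  by_contra hcon
  simp only [not_or, not_exists, not_and, IsOmegaStart, not_forall, not_not] at hcon
  set S := {t | t ∈ I ∧ HasSuccChain t} with hS
  have hnext : ∀ z : S, ∃ z' : S, (z' : W) ⋖ z := by
    rintro ⟨z, hz, hz'⟩
    obtain ⟨y, hy⟩ := hcon.2 z hz hz'
    exact ⟨⟨y, hI z hz y (Or.inr hy), hz'.of_covBy hy⟩, hy⟩
  choose s hs using hnext
  let g : ℕ → S := fun n => s^[n] ⟨x, hx, h⟩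
  refine hcon.1 ⟨fun n => OrderDual.toDual (g n : W), rfl, fun n => ?_⟩
  simp only [g, Function.iterate_succ_apply']
  exact toDual_covBy_toDual_iff.2 (hs _)

/-- In a scattered order, an infinite convex union of finite-distance classes contains a class of
type `ζ`, `ω` or `ω*`. -/
theorem IsScattered.exists_start_or (h : IsScattered W) {I : Set W} (hI : I.OrdConnected)
    (hinf : I.Infinite) (hIc : IsCovClosed I) :
    (∃ x ∈ I, HasSuccChain x ∧ HasSuccChain (OrderDual.toDual x)) ∨ (∃ t ∈ I, IsOmegaStart t) ∨
      ∃ s ∈ I, IsOmegaStart (OrderDual.toDual s) := by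
  obtain ⟨x, hx, hxinf⟩ := h.exists_infinite_class hI hinf
  have hsub : {y ∈ I | (uIcc x y).Finite} ⊆ {y | x ≤ y ∧ (Icc x y).Finite} ∪
      {y | y ≤ x ∧ (Icc y x).Finite} := by
    rintro y ⟨-, hy⟩
    rcases le_total x y with hxy | hxy
    · exact Or.inl ⟨hxy, by rwa [uIcc_of_le hxy] at hy⟩
    · exact Or.inr ⟨hxy, by rwa [uIcc_of_ge hxy] at hy⟩
  rcases infinite_union.1 (hxinf.mono hsub) with h1 | h1
  · have hs := hasSuccChain_of_infinite h1
    rcases hs.exists_start hIc hx with h2 | h2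
    exacts [Or.inl ⟨x, hx, hs, h2⟩, Or.inr (Or.inl h2)]
  · have hs : HasSuccChain (OrderDual.toDual x) := by
      refine hasSuccChain_of_infinite ((h1.image OrderDual.toDual.injective.injOn).mono ?_)
      rintro _ ⟨y, ⟨hy, hfin⟩, rfl⟩
      refine ⟨hy, ?_⟩
      rw [Icc_toDual]
      exact hfin.preimage OrderDual.ofDual.injective.injOn
    rcases hs.exists_start hIc.dual (x := OrderDual.toDual x) hx with h2 | ⟨s, hs, h2⟩
    exacts [Or.inl ⟨x, hx, h2, hs⟩, Or.inr (Or.inr ⟨OrderDual.ofDual s, hs, h2⟩)]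

/-- A class of type `ω` as an embedding of `ℕ`. -/
theorem IsOmegaStart.exists_embedding {t : W} (h : IsOmegaStart t) :
    ∃ g : ℕ ↪o W, g 0 = t ∧ (∀ n, g n ⋖ g (n + 1)) ∧ PreservesAdjacency g := by
  obtain ⟨⟨g, rfl, hg⟩, ht⟩ := h
  refine ⟨OrderEmbedding.ofStrictMono g (strictMono_of_chain hg), rfl, hg, ?_, ?_, ?_⟩
  · intro a b hab
    rw [Nat.covBy_iff_add_one_eq] at hab
    subst hab
    exact hg a
  · intro a x hx
    exact ⟨a + 1, (hg a).unique_right hx⟩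
  · intro a x hx
    rcases a with _ | a
    · exact (ht _ hx).elim
    · exact ⟨a, (hg a).unique_left hx⟩

/-- A class of type `ζ` as an embedding of `ω* + ω`. -/
theorem exists_zeta_embedding {x : W} (h1 : HasSuccChain x)
    (h2 : HasSuccChain (OrderDual.toDual x)) : ∃ g : ℕᵒᵈ ⊕ₗ ℕ ↪o W, PreservesAdjacency g ∧
      (range g).OrdConnected ∧ x ∈ range g := by
  obtain ⟨u, rfl, hu⟩ := h1
  obtain ⟨v, hv0, hv⟩ := h2
  have hum := strictMono_of_chain hu
  have hvm := strictMono_of_chain hv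
  let p : ℕᵒᵈ ↪o W := dualEmbedding (OrderEmbedding.ofStrictMono (fun n => v (n + 1))
    fun a b hab => hvm (by omega))
  let q : ℕ ↪o W := OrderEmbedding.ofStrictMono u hum
  have hv' : ∀ n, OrderDual.ofDual (v (n + 1)) ⋖ OrderDual.ofDual (v n) := fun n =>
    ofDual_covBy_ofDual_iff.2 (hv n)
  have hv0' : OrderDual.ofDual (v 0) = u 0 := congrArg OrderDual.ofDual hv0
  have hpq : ∀ a b, p a < q b := fun a b => by
    have : OrderDual.ofDual (v (OrderDual.ofDual a + 1)) < OrderDual.ofDual (v 0) :=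
      hvm (Nat.succ_pos _)
    exact (hv0' ▸ this).trans_le (hum.monotone (Nat.zero_le b))
  have hrange : ∀ z, z ∈ range (sumEmbedding p q hpq) ↔
      (OrderDual.toDual z ∈ range v) ∨ z ∈ range u := by
    intro z
    rw [range_sumEmbedding]
    constructor
    · rintro (⟨a, rfl⟩ | ⟨b, rfl⟩)
      exacts [Or.inl ⟨_, rfl⟩, Or.inr ⟨b, rfl⟩]
    · rintro (⟨n, hn⟩ | ⟨b, rfl⟩)
      · rcases n with _ | n
        · exact Or.inr ⟨0, (hv0'.symm.trans (congrArg OrderDual.ofDual hn) : u 0 = z)⟩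
        · exact Or.inl ⟨OrderDual.toDual n, congrArg OrderDual.ofDual hn⟩
      · exact Or.inr ⟨b, rfl⟩
  have hconn : (range (sumEmbedding p q hpq)).OrdConnected := by
    have hbd : ∀ z ∈ range (sumEmbedding p q hpq), (∃ n, OrderDual.ofDual (v n) ≤ z) ∧
        ∃ n, z ≤ u n := by
      intro z hz
      rcases (hrange z).1 hz with ⟨n, hn⟩ | ⟨n, rfl⟩
      · obtain rfl : OrderDual.ofDual (v n) = z := congrArg OrderDual.ofDual hn
        exact ⟨⟨n, le_rfl⟩, 0, hv0' ▸ hvm.monotone (Nat.zero_le n)⟩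
      · exact ⟨⟨0, hv0' ▸ hum.monotone (Nat.zero_le n)⟩, n, le_rfl⟩
    refine ⟨fun x hx y hy z hz => (hrange z).2 ?_⟩
    obtain ⟨m, hm⟩ := (hbd x hx).1
    obtain ⟨n, hn⟩ := (hbd y hy).2
    rcases le_total (u 0) z with h | h
    · exact Or.inr (mem_range_of_chain hu h (hz.2.trans hn))
    · refine Or.inl (mem_range_of_chain hv (b := OrderDual.toDual z) (k := m) ?_ (hm.trans hz.1))
      rw [hv0]; exact h
  refine ⟨sumEmbedding p q hpq, ⟨fun hab => hab.image _ hconn, ?_, ?_⟩, hconn,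
    (hrange _).2 (Or.inr ⟨0, rfl⟩)⟩
  · intro a x hx
    have ha : sumEmbedding p q hpq a ∈ range (sumEmbedding p q hpq) := ⟨a, rfl⟩
    generalize sumEmbedding p q hpq a = z at hx ha
    rcases (hrange _).1 ha with ⟨n, hn⟩ | ⟨n, rfl⟩
    · obtain rfl : OrderDual.ofDual (v n) = z := congrArg OrderDual.ofDual hn
      rcases n with _ | n
      · exact (hrange _).2 (Or.inr ⟨1, (hu 0).unique_right (hv0' ▸ hx)⟩)
      · exact (hrange _).2 (Or.inl ⟨n, congrArg OrderDual.toDual ((hv' n).unique_right hx)⟩)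
    · exact (hrange _).2 (Or.inr ⟨n + 1, (hu n).unique_right hx⟩)
  · intro a x hx
    have ha : sumEmbedding p q hpq a ∈ range (sumEmbedding p q hpq) := ⟨a, rfl⟩
    generalize sumEmbedding p q hpq a = z at hx ha
    rcases (hrange _).1 ha with ⟨n, hn⟩ | ⟨n, rfl⟩
    · obtain rfl : OrderDual.ofDual (v n) = z := congrArg OrderDual.ofDual hn
      exact (hrange _).2 (Or.inl ⟨n + 1, congrArg OrderDual.toDual ((hv' n).unique_left hx)⟩)
    · rcases n with _ | n
      · exact (hrange _).2 (Or.inl ⟨1, congrArg OrderDual.toDual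
          ((hv' 0).unique_left (hv0'.symm ▸ hx))⟩)
      · exact (hrange _).2 (Or.inr ⟨n, (hu n).unique_left hx⟩)

end Chains

/-! ### Lower, upper and middle part of an order -/

section Parts

variable {W : Type*} [LinearOrder W]

/-- The points with finitely many points below them. -/
def lowerPart (W : Type*) [LinearOrder W] : Set W := {x | (Iic x).Finite}

/-- The points with finitely many points above them. -/
def upperPart (W : Type*) [LinearOrder W] : Set W := {x | (Ici x).Finite}

/-- The points at infinite distance from both ends of the order. -/
def middlePart (W : Type*) [LinearOrder W] : Set W := (lowerPart W ∪ upperPart W)ᶜ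

theorem mem_lowerPart_dual {x : W} : OrderDual.toDual x ∈ lowerPart Wᵒᵈ ↔ x ∈ upperPart W := by
  simp only [lowerPart, upperPart, mem_ofPred_eq, Iic_toDual]
  exact ⟨fun h => h.preimage OrderDual.toDual.injective.injOn,
    fun h => h.preimage OrderDual.ofDual.injective.injOn⟩

theorem mem_upperPart_dual {x : W} : OrderDual.toDual x ∈ upperPart Wᵒᵈ ↔ x ∈ lowerPart W := by
  simp only [lowerPart, upperPart, mem_ofPred_eq, Ici_toDual]
  exact ⟨fun h => h.preimage OrderDual.toDual.injective.injOn,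
    fun h => h.preimage OrderDual.ofDual.injective.injOn⟩

theorem mem_middlePart_dual {x : W} : OrderDual.toDual x ∈ middlePart Wᵒᵈ ↔ x ∈ middlePart W := by
  simp only [middlePart, mem_compl_iff, mem_union, mem_lowerPart_dual, mem_upperPart_dual, or_comm]

theorem isLowerSet_lowerPart : IsLowerSet (lowerPart W) :=
  fun _ _ hba ha => Finite.subset ha (Iic_subset_Iic.2 hba)

theorem isUpperSet_upperPart : IsUpperSet (upperPart W) :=
  fun _ _ hba ha => Finite.subset ha (Ici_subset_Ici.2 hba)

theorem mem_lowerPart_of_finite_Iio {x : W} (h : (Iio x).Finite) : x ∈ lowerPart W := by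
  rw [lowerPart, mem_ofPred_eq, ← Iio_insert]; exact h.insert x

theorem mem_upperPart_of_finite_Ioi {x : W} (h : (Ioi x).Finite) : x ∈ upperPart W := by
  rw [upperPart, mem_ofPred_eq, ← Ioi_insert]; exact h.insert x

theorem lt_of_mem_lowerPart_of_mem_upperPart [Infinite W] {x y : W} (hx : x ∈ lowerPart W)
    (hy : y ∈ upperPart W) : x < y := by
  by_contra h
  refine infinite_univ (α := W) ((Finite.union hx hy).subset fun z _ => ?_)
  exact (le_total z x).imp id fun hz => (not_lt.1 h).trans hz

theorem lt_of_mem_lowerPart_of_notMem {x y : W} (hx : x ∈ lowerPart W) (hy : y ∉ lowerPart W) :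
    x < y :=
  not_le.1 fun h => hy (isLowerSet_lowerPart h hx)

theorem lt_of_notMem_of_mem_upperPart {x y : W} (hx : x ∉ upperPart W) (hy : y ∈ upperPart W) :
    x < y :=
  not_le.1 fun h => hx (isUpperSet_upperPart h hy)

theorem ordConnected_middlePart : (middlePart W).OrdConnected :=
  ⟨fun _ hx _ hy _ hz h => h.elim (fun h => hx (Or.inl (isLowerSet_lowerPart hz.1 h)))
    fun h => hy (Or.inr (isUpperSet_upperPart hz.2 h))⟩

theorem mem_lowerPart_of_covBy {x y : W} (hx : x ∈ lowerPart W) (h : x ⋖ y) : y ∈ lowerPart W :=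
  mem_lowerPart_of_finite_Iio (Finite.subset hx fun _ hz => not_lt.1 fun hxz => h.2 hxz hz)

theorem mem_upperPart_of_covBy {x y : W} (hx : x ∈ upperPart W) (h : y ⋖ x) : y ∈ upperPart W :=
  mem_upperPart_of_finite_Ioi (Finite.subset hx fun _ hz => not_lt.1 fun hxz => h.2 hz hxz)

theorem isCovClosed_middlePart : IsCovClosed (middlePart W) := by
  rintro x hx y (h | h) (hy | hy)
  · exact hx (Or.inl (isLowerSet_lowerPart h.le hy))
  · exact hx (Or.inr (mem_upperPart_of_covBy hy h))
  · exact hx (Or.inl (mem_lowerPart_of_covBy hy h))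
  · exact hx (Or.inr (isUpperSet_upperPart h.le hy))

theorem PreservesAdjacency.of_range_eq_lowerPart {P : Type*} [LinearOrder P] {p : P ↪o W}
    (hp : range p = lowerPart W) : PreservesAdjacency p where
  map_covBy h := h.image _ (hp ▸ isLowerSet_lowerPart.ordConnected)
  mem_range_of_covBy {a _} hx := hp ▸ mem_lowerPart_of_covBy (hp ▸ ⟨a, rfl⟩ : p a ∈ lowerPart W) hx
  mem_range_of_covBy' {a _} hx :=
    hp ▸ isLowerSet_lowerPart hx.le (hp ▸ ⟨a, rfl⟩ : p a ∈ lowerPart W)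

/-- The lower part of any order is finite or of type `ω`. -/
theorem exists_embedding_lowerPart (W : Type*) [LinearOrder W] :
    ∃ (P : Type) (_ : LinearOrder P) (p : P ↪o W), IsPrimrecOrder P ∧ range p = lowerPart W ∧
      ((lowerPart W).Infinite → NoMaxOrder P ∧ Nonempty P) := by
  by_cases hfin : (lowerPart W).Finite
  · refine ⟨Fin hfin.toFinset.card, inferInstance, hfin.toFinset.orderEmbOfFin rfl,
      isPrimrecOrder_fin _, by simp, fun h => (h hfin).elim⟩
  obtain ⟨x, hx⟩ := Set.Infinite.nonempty hfin
  obtain ⟨m, hm, hmin⟩ := Finite.exists_minimal hx ⟨x, mem_Iic.2 le_rfl⟩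
  have hbot : ∀ y, m ≤ y := fun y => by
    rcases le_total y m with h | h
    · exact hmin (h.trans hm) h
    · exact h
  obtain ⟨g, rfl, hg⟩ : HasSuccChain m := hasSuccChain_of_infinite <|
    Set.Infinite.mono (fun y hy => ⟨hbot y, Finite.subset hy Icc_subset_Iic_self⟩) hfin
  have hgm := strictMono_of_chain hg
  refine ⟨ℕ, inferInstance, OrderEmbedding.ofStrictMono g hgm, isPrimrecOrder_nat, ?_,
    fun _ => ⟨inferInstance, inferInstance⟩⟩
  ext y
  constructor
  · rintro ⟨n, rfl⟩
    exact ((finite_Iic n).image g).subset fun z hz =>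
      let ⟨k, hk⟩ := mem_range_of_chain hg (hbot z) hz
      ⟨k, hgm.le_iff_le.1 (hk.trans_le hz), hk⟩
  · intro hy
    obtain ⟨_, ⟨n, rfl⟩, hn⟩ := ((infinite_range_of_injective hgm.injective).sdiff hy).nonempty
    exact mem_range_of_chain hg (hbot y) (not_le.1 hn).le

/-- If only finitely many points are at infinite distance from both ends, and there are some, then
the upper part is infinite. -/
theorem infinite_upperPart_of_finite_middlePart (h : (middlePart W).Finite)
    (hne : (middlePart W).Nonempty) : (upperPart W).Infinite := by
  intro hfin
  obtain ⟨b, hb, hmax⟩ := h.exists_maximal hne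
  refine hb (Or.inr (mem_upperPart_of_finite_Ioi (hfin.subset fun z hz => ?_)))
  by_contra hz'
  have hzm : z ∈ middlePart W := fun hz2 =>
    hz2.elim (fun h => hb (Or.inl (isLowerSet_lowerPart (le_of_lt hz) h))) hz'
  exact (hmax hzm (le_of_lt hz)).not_gt hz

theorem infinite_lowerPart_of_finite_middlePart (h : (middlePart W).Finite)
    (hne : (middlePart W).Nonempty) : (lowerPart W).Infinite := by
  intro hfin
  obtain ⟨b, hb, hmin⟩ := h.exists_minimal hne
  refine hb (Or.inl (mem_lowerPart_of_finite_Iio (hfin.subset fun z hz => ?_)))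
  by_contra hz'
  have hzm : z ∈ middlePart W := fun hz2 =>
    hz2.elim hz' (fun h => hb (Or.inr (isUpperSet_upperPart (le_of_lt hz) h)))
  exact (hmin hzm (le_of_lt hz)).not_gt hz

theorem exists_isLeast_or_strictAnti {T : Set W} (hT : T.Nonempty) :
    (∃ t, IsLeast T t) ∨ ∃ t : ℕ → W, StrictAnti t ∧ ∀ n, t n ∈ T := by
  by_cases h : T.IsWF
  · exact Or.inl ⟨h.min hT, h.min_mem hT, fun _ ha => h.min_le hT ha⟩
  · rw [isWF_iff_no_descending_seq] at h
    push Not at h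
    exact Or.inr h

theorem exists_isGreatest_or_strictMono {S : Set W} (hS : S.Nonempty) :
    (∃ s, IsGreatest S s) ∨ ∃ s : ℕ → Wᵒᵈ, StrictAnti s ∧ ∀ n, OrderDual.ofDual (s n) ∈ S := by
  rcases exists_isLeast_or_strictAnti (W := Wᵒᵈ) (T := OrderDual.ofDual ⁻¹' S) hS with
    ⟨s, h1, h2⟩ | h
  · exact Or.inl ⟨OrderDual.ofDual s, h1, fun x hx => h2 (a := OrderDual.toDual x) hx⟩
  · exact Or.inr h

theorem infinite_Ioo_of_no_pred {s t : W} (ht : ∀ y, ¬ y ⋖ t) (h : s < t) : (Ioo s t).Infinite :=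
  fun hfin => let ⟨z, _, hz⟩ := exists_covBy_of_finite_Ioo h hfin; ht z hz

/-- If a scattered infinite order has finite lower and upper parts, its middle part contains a class
of type `ζ`, or a descending sequence of classes of type `ω`, or an ascending sequence of classes
of type `ω*`. -/
theorem IsScattered.middlePart_trichotomy [Infinite W] (hW : IsScattered W)
    (hX : (lowerPart W).Finite) (hY : (upperPart W).Finite) :
    (∃ x ∈ middlePart W, HasSuccChain x ∧ HasSuccChain (OrderDual.toDual x)) ∨
      (∃ t : ℕ → W, StrictAnti t ∧ ∀ n, t n ∈ middlePart W ∧ IsOmegaStart (t n)) ∨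
      ∃ s : ℕ → Wᵒᵈ, StrictAnti s ∧
        ∀ n, OrderDual.ofDual (s n) ∈ middlePart W ∧ IsOmegaStart (s n) := by
  by_contra! hcon
  obtain ⟨hz, hT, hS⟩ := hcon
  have hz' : ∀ I ⊆ middlePart W, ¬ ∃ x ∈ I, HasSuccChain x ∧ HasSuccChain (OrderDual.toDual x) :=
    fun I hI ⟨x, hx, h1, h2⟩ => hz x (hI hx) h1 h2
  -- without such sequences there is a first class of type `ω` and a last class of type `ω*`
  have hleast : ∀ I ⊆ middlePart W, (∃ t ∈ I, IsOmegaStart t) →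
      ∃ t, IsLeast {t ∈ I | IsOmegaStart t} t := by
    rintro I hI ⟨t, ht⟩
    rcases exists_isLeast_or_strictAnti (T := {t ∈ I | IsOmegaStart t}) ⟨t, ht⟩ with
      h | ⟨f, hf, hfm⟩
    · exact h
    · obtain ⟨n, hn⟩ := hT f hf
      exact (hn (hI (hfm n).1) (hfm n).2).elim
  have hgreatest : ∀ I ⊆ middlePart W, (∃ s ∈ I, IsOmegaStart (OrderDual.toDual s)) →
      ∃ s, IsGreatest {s ∈ I | IsOmegaStart (OrderDual.toDual s)} s := by
    rintro I hI ⟨s, hs⟩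
    rcases exists_isGreatest_or_strictMono (S := {s ∈ I | IsOmegaStart (OrderDual.toDual s)})
      ⟨s, hs⟩ with h | ⟨f, hf, hfm⟩
    · exact h
    · obtain ⟨n, hn⟩ := hS f hf
      exact (hn (hI (hfm n).1) (hfm n).2).elim
  have hJinf : (middlePart W).Infinite := (hX.union hY).infinite_compl
  have hJc := isCovClosed_middlePart (W := W)
  have hJo := ordConnected_middlePart (W := W)
  by_cases hs : ∃ s ∈ middlePart W, IsOmegaStart (OrderDual.toDual s)
  · obtain ⟨s, ⟨hsJ, hss⟩, hsmax⟩ := hgreatest _ subset_rfl hs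
    have hnos : ∀ y, ¬ s ⋖ y := fun y hy => hss.2 _ (toDual_covBy_toDual_iff.2 hy)
    have hinf1 : (middlePart W ∩ Ioi s).Infinite := by
      intro hfin
      refine hsJ (Or.inr (mem_upperPart_of_finite_Ioi ((hfin.union hY).subset fun z hz => ?_)))
      by_cases hzY : z ∈ upperPart W
      · exact Or.inr hzY
      · exact Or.inl ⟨fun h => h.elim
          (fun h => hsJ (Or.inl (isLowerSet_lowerPart (le_of_lt hz) h))) hzY, hz⟩
    rcases hW.exists_start_or (hJo.inter ordConnected_Ioi) hinf1
      (hJc.inter (isCovClosed_Ioi hnos)) with h | h | ⟨s', hs', hss'⟩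
    · exact hz' _ inter_subset_left h
    · obtain ⟨t, ⟨⟨htJ, hst⟩, htt⟩, htmin⟩ := hleast _ inter_subset_left h
      rcases hW.exists_start_or ((hJo.inter ordConnected_Ioi).inter (ordConnected_Iio (a := t)))
        ((infinite_Ioo_of_no_pred htt.2 hst).mono fun y hy =>
          ⟨⟨hJo.out hsJ htJ ⟨hy.1.le, hy.2.le⟩, hy.1⟩, hy.2⟩)
        ((hJc.inter (isCovClosed_Ioi hnos)).inter (isCovClosed_Iio htt.2)) with
        h | ⟨t', ht', htt'⟩ | ⟨s', hs', hss'⟩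
      · exact hz' _ (inter_subset_left.trans inter_subset_left) h
      · exact (htmin ⟨ht'.1, htt'⟩).not_gt ht'.2
      · exact (hsmax ⟨hs'.1.1, hss'⟩).not_gt hs'.1.2
    · exact (hsmax ⟨hs'.1, hss'⟩).not_gt hs'.2
  · rcases hW.exists_start_or hJo hJinf hJc with h | h | h
    · exact hz' _ subset_rfl h
    · obtain ⟨t, ⟨htJ, htt⟩, htmin⟩ := hleast _ subset_rfl h
      have hinf1 : (middlePart W ∩ Iio t).Infinite := by
        intro hfin
        refine htJ (Or.inl (mem_lowerPart_of_finite_Iio ((hfin.union hX).subset fun z hz => ?_)))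
        by_cases hzX : z ∈ lowerPart W
        · exact Or.inr hzX
        · exact Or.inl ⟨fun h => h.elim hzX
            (fun h => htJ (Or.inr (isUpperSet_upperPart (le_of_lt hz) h))), hz⟩
      rcases hW.exists_start_or (hJo.inter ordConnected_Iio) hinf1
        (hJc.inter (isCovClosed_Iio htt.2)) with h | ⟨t', ht', htt'⟩ | ⟨s', hs', hss'⟩
      · exact hz' _ inter_subset_left h
      · exact (htmin ⟨ht'.1, htt'⟩).not_gt ht'.2
      · exact hs ⟨s', hs'.1, hss'⟩
    · exact hs h

/-- Every other member of a descending sequence of classes of type `ω`, as an embedding of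
`ω · ω*`. The omitted members make the complement infinite. -/
theorem exists_embedding_of_strictAnti {t : ℕ → W} (ht : StrictAnti t)
    (hs : ∀ n, IsOmegaStart (t n)) {I : Set W} (htI : ∀ n, t n ∈ I) :
    ∃ m : ℕᵒᵈ ×ₗ ℕ ↪o W, PreservesAdjacency m ∧ (I \ range m).Infinite := by
  choose g hg0 hg hgp using fun n => (hs n).exists_embedding
  have hlt : ∀ i j, i < j → ∀ x, g j x < t i := by
    intro i j hij x
    induction x with
    | zero => rw [hg0]; exact ht hij
    | succ x ih =>
      refine lt_of_le_of_ne (not_lt.1 fun h => (hg j x).2 ih h) fun e => ?_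
      exact (hs i).2 _ (e ▸ hg j x)
  have hlt' : ∀ i j : ℕᵒᵈ, i < j → ∀ x y,
      g (2 * OrderDual.ofDual i) x < g (2 * OrderDual.ofDual j) y := by
    intro i j hij x y
    have hij' : OrderDual.ofDual j < OrderDual.ofDual i := hij
    refine (hlt (2 * OrderDual.ofDual j) (2 * OrderDual.ofDual i) (by omega) x).trans_le ?_
    rw [← hg0]
    exact (g _).monotone (Nat.zero_le y)
  refine ⟨prodEmbedding (ι := ℕᵒᵈ) (fun i => g (2 * OrderDual.ofDual i)) hlt',
    PreservesAdjacency.prod (fun i => hgp _) hlt', ?_⟩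
  · have hinj : Function.Injective fun n => t (2 * n + 1) := fun a b hab => by
      have := ht.injective hab
      omega
    refine (infinite_range_of_injective hinj).mono ?_
    rintro _ ⟨n, rfl⟩
    refine ⟨htI _, ?_⟩
    rintro ⟨s, hs'⟩
    obtain ⟨⟨i, x⟩, rfl⟩ := toLex.surjective s
    have hs' : g (2 * OrderDual.ofDual i) x = t (2 * n + 1) := hs'
    cases x with
    | zero =>
      rw [hg0] at hs'
      have := ht.injective hs'
      omega
    | succ x => exact (hs (2 * n + 1)).2 _ (hs' ▸ hg _ x)

theorem range_subset_middlePart {P : Type*} [LinearOrder P] [NoMinOrder P] [NoMaxOrder P]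
    (p : P ↪o W) : range p ⊆ middlePart W := by
  rintro _ ⟨a, rfl⟩ (h | h)
  · exact (Iic_infinite a) ((Finite.preimage p.injective.injOn h).subset
      fun b hb => p.le_iff_le.2 hb)
  · exact (Ici_infinite a) ((Finite.preimage p.injective.injOn h).subset
      fun b hb => p.le_iff_le.2 hb)

/-- The complement of a convex set in the middle part is empty or infinite: a first
point outside, if it is below the convex set, would have only points of the lower part below it. -/
theorem middlePart_diff_eq_empty {K : Set W} (hK : K.OrdConnected) (hne : K.Nonempty)
    (hX : (lowerPart W).Finite) (hY : (upperPart W).Finite) (hfin : (middlePart W \ K).Finite) :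
    middlePart W \ K = ∅ := by
  by_contra hcon
  have hne' := nonempty_iff_ne_empty.2 hcon
  obtain ⟨x, hx⟩ := hne
  obtain ⟨b, hb, hbmin⟩ := hfin.exists_minimal hne'
  obtain ⟨c, hc, hcmax⟩ := hfin.exists_maximal hne'
  have hcb : c ≤ x := by
    by_contra! h
    refine hc.1 (Or.inr (mem_upperPart_of_finite_Ioi (hY.subset fun z hz => ?_)))
    by_contra hzY
    have hzm : z ∈ middlePart W := fun hz2 =>
      hz2.elim (fun h => hc.1 (Or.inl (isLowerSet_lowerPart (le_of_lt hz) h))) hzY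
    by_cases hzK : z ∈ K
    · exact hc.2 (hK.out hx hzK ⟨h.le, le_of_lt hz⟩)
    · exact (hcmax ⟨hzm, hzK⟩ (le_of_lt hz)).not_gt hz
  have hbx : x ≤ b := by
    by_contra! h
    refine hb.1 (Or.inl (mem_lowerPart_of_finite_Iio (hX.subset fun z hz => ?_)))
    by_contra hzX
    have hzm : z ∈ middlePart W := fun hz2 =>
      hz2.elim hzX (fun h => hb.1 (Or.inr (isUpperSet_upperPart (le_of_lt hz) h)))
    by_cases hzK : z ∈ K
    · exact hb.2 (hK.out hzK hx ⟨le_of_lt hz, h.le⟩)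
    · exact (hbmin ⟨hzm, hzK⟩ (le_of_lt hz)).not_gt hz
  have hbc : b ≤ c := (le_total b c).elim id fun h => hbmin hc h
  obtain rfl : x = b := le_antisymm hbx (hbc.trans hcb)
  exact hb.2 hx

/-- A scattered infinite order with finite lower and upper parts has a primitive recursive suborder
without endpoints that is a union of finite-distance classes. -/
theorem IsScattered.exists_middle [Infinite W] (hW : IsScattered W)
    (hX : (lowerPart W).Finite) (hY : (upperPart W).Finite) :
    ∃ (M : Type) (_ : LinearOrder M) (m : M ↪o W), IsPrimrecOrder M ∧ NoMinOrder M ∧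
      NoMaxOrder M ∧ Nonempty M ∧ PreservesAdjacency m ∧
      ((middlePart W \ range m).Finite → middlePart W \ range m = ∅) := by
  have hprim : IsPrimrecOrder (ℕᵒᵈ ×ₗ ℕ) := isPrimrecOrder_nat.dual.prodLex isPrimrecOrder_nat
  have hne : Nonempty (ℕᵒᵈ ×ₗ ℕ) := ⟨toLex (OrderDual.toDual 0, 0)⟩
  rcases hW.middlePart_trichotomy hX hY with ⟨x, -, h1, h2⟩ | ⟨t, ht, hts⟩ | ⟨s, hs, hss⟩
  · obtain ⟨m, hm, hconn, hxm⟩ := exists_zeta_embedding h1 h2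
    exact ⟨ℕᵒᵈ ⊕ₗ ℕ, inferInstance, m, isPrimrecOrder_zeta,
      inferInstance, inferInstance, ⟨toLex (Sum.inr 0)⟩, hm,
      middlePart_diff_eq_empty hconn ⟨x, hxm⟩ hX hY⟩
  · obtain ⟨m, hm, hinf⟩ := exists_embedding_of_strictAnti ht (fun n => (hts n).2)
      fun n => (hts n).1
    exact ⟨ℕᵒᵈ ×ₗ ℕ, inferInstance, m, hprim, inferInstance, inferInstance, hne, hm,
      fun h => (hinf h).elim⟩
  · obtain ⟨m, hm, hinf⟩ := exists_embedding_of_strictAnti hs (fun n => (hss n).2)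
      fun n => mem_middlePart_dual.2 (hss n).1
    refine ⟨(ℕᵒᵈ ×ₗ ℕ)ᵒᵈ, inferInstance, dualEmbedding m, hprim.dual, inferInstance, inferInstance,
      hne, hm.dualEmbedding, fun h => (hinf ((h.image OrderDual.toDual).subset ?_)).elim⟩
    rintro y ⟨hy, hym⟩
    exact ⟨OrderDual.ofDual y, ⟨mem_middlePart_dual.1 hy, hym⟩, rfl⟩

end Parts

/-! ### Tame primitive recursive suborders of scattered orders -/

section Skeleton

variable {W : Type*} [LinearOrder W]

/-- There is a tame suborder `P + Q` of `W` with primitive recursive `P` and `Q`, and a primitive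
recursive order `R` with as many points as the suborder omits, such that `P + Q` is also a tame
suborder of `P + R + Q`. -/
def HasPrimrecSkeleton (W : Type*) [LinearOrder W] : Prop :=
  ∃ (P R Q : Type) (_ : LinearOrder P) (_ : LinearOrder R) (_ : LinearOrder Q),
    IsPrimrecOrder P ∧ IsPrimrecOrder R ∧ IsPrimrecOrder Q ∧ Infinite (P ⊕ₗ Q) ∧
    IsTame (insertEmbedding P R Q) ∧
    ∃ f : P ⊕ₗ Q ↪o W, IsTame f ∧ Nonempty (↥(range f)ᶜ ≃ R)

theorem infinite_sumLex {P Q : Type} [LinearOrder P] [LinearOrder Q]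
    (h : NoMaxOrder P ∧ Nonempty P ∨ NoMinOrder Q ∧ Nonempty Q) : Infinite (P ⊕ₗ Q) := by
  rcases h with ⟨h, h'⟩ | ⟨h, h'⟩
  · have : Infinite P := NoMaxOrder.infinite
    exact Infinite.of_injective _ (Sum.Lex.inl_strictMono (α := P) (β := Q)).injective
  · have : Infinite Q := NoMinOrder.infinite
    exact Infinite.of_injective _ (Sum.Lex.inr_strictMono (α := P) (β := Q)).injective

/-- The omitted points can be replaced by nothing, by a copy of `ζ`, or, if there are finitely many,
by a finite order between a copy of `ω` and a copy of `ω*`. -/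
theorem IsTame.hasPrimrecSkeleton [Countable W] {P Q : Type} [LinearOrder P] [LinearOrder Q]
    (hP : IsPrimrecOrder P) (hQ : IsPrimrecOrder Q) {f : P ⊕ₗ Q ↪o W} (hf : IsTame f)
    (hPQ : NoMaxOrder P ∧ Nonempty P ∨ NoMinOrder Q ∧ Nonempty Q)
    (h : (range f)ᶜ.Finite → (range f)ᶜ.Nonempty →
      (NoMaxOrder P ∧ Nonempty P) ∧ (NoMinOrder Q ∧ Nonempty Q)) :
    HasPrimrecSkeleton W := by
  have hinf := infinite_sumLex hPQ
  by_cases hfin : (range f)ᶜ.Finite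
  · have := hfin.to_subtype
    refine ⟨P, Fin (Nat.card ↥(range f)ᶜ), Q, inferInstance, inferInstance, inferInstance, hP,
      isPrimrecOrder_fin _, hQ, hinf, ?_, f, hf, ⟨Finite.equivFin _⟩⟩
    rcases (range f)ᶜ.eq_empty_or_nonempty with he | hne
    · have : IsEmpty (Fin (Nat.card ↥(range f)ᶜ)) := by
        rw [he, Nat.card_of_isEmpty]; infer_instance
      have h1 : NoMinOrder (Fin (Nat.card ↥(range f)ᶜ)) := ⟨fun a => isEmptyElim a⟩
      have h2 : NoMaxOrder (Fin (Nat.card ↥(range f)ᶜ)) := ⟨fun a => isEmptyElim a⟩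
      exact isTame_insertEmbedding (Or.inr h1) (Or.inl h2) hPQ (Or.inr h1) (Or.inr h2)
    · obtain ⟨⟨h1, h2⟩, h3, h4⟩ := h hfin hne
      exact isTame_insertEmbedding (Or.inl h1) (Or.inr h3) hPQ (Or.inl h2) (Or.inl h4)
  · have : Infinite ↥(range f)ᶜ := Set.infinite_coe_iff.2 hfin
    have hinf' : Infinite (ℕᵒᵈ ⊕ₗ ℕ) := inferInstanceAs (Infinite (ℕ ⊕ ℕ))
    have hc : Countable (ℕᵒᵈ ⊕ₗ ℕ) := inferInstanceAs (Countable (ℕ ⊕ ℕ))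
    refine ⟨P, ℕᵒᵈ ⊕ₗ ℕ, Q, inferInstance, inferInstance, inferInstance, hP, isPrimrecOrder_zeta,
      hQ, hinf, ?_, f, hf, nonempty_equiv_of_countable⟩
    exact isTame_insertEmbedding (Or.inr inferInstance) (Or.inl inferInstance) hPQ
      (Or.inr inferInstance) (Or.inr inferInstance)

/-- The suborder consists of the lower part, the upper part and, if both are finite, a piece of the
middle part that separates them. -/
theorem IsScattered.hasPrimrecSkeleton [Countable W] [Infinite W] (hW : IsScattered W) :
    HasPrimrecSkeleton W := by
  obtain ⟨P, _, p, hP, hpr, hPinf⟩ := exists_embedding_lowerPart W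
  obtain ⟨Q', _, q', hQ', hqr', hQinf⟩ := exists_embedding_lowerPart Wᵒᵈ
  have hpa := PreservesAdjacency.of_range_eq_lowerPart hpr
  have hqa := (PreservesAdjacency.of_range_eq_lowerPart hqr').dualEmbedding
  have hqr : range (dualEmbedding q') = upperPart W := by
    rw [range_dualEmbedding, hqr']
    ext x
    exact mem_lowerPart_dual
  have hQ := hQ'.dual
  have hQinf' : (upperPart W).Infinite → NoMinOrder Q'ᵒᵈ ∧ Nonempty Q'ᵒᵈ := fun h => by
    obtain ⟨h1, h2⟩ := hQinf fun hfin => h ((hfin.image OrderDual.ofDual).subset fun x hx =>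
      ⟨OrderDual.toDual x, mem_lowerPart_dual.2 hx, rfl⟩)
    exact ⟨inferInstance, h2⟩
  generalize dualEmbedding q' = q at hqa hqr
  have hpx : ∀ a, p a ∈ lowerPart W := fun a => hpr ▸ ⟨a, rfl⟩
  have hqx : ∀ b, q b ∈ upperPart W := fun b => hqr ▸ ⟨b, rfl⟩
  have hmin : ∀ x : W, IsMin x → x ∈ range p := fun x hx => by
    rw [hpr, lowerPart, mem_ofPred_eq, hx.Iic_eq]; exact finite_singleton x
  have hmax : ∀ x : W, IsMax x → x ∈ range q := fun x hx => by
    rw [hqr, upperPart, mem_ofPred_eq, hx.Ici_eq]; exact finite_singleton x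
  have hqmax : ∀ b, IsMax b → IsMax (q b) := fun b hb x hx => by
    obtain ⟨c, rfl⟩ : x ∈ range q := hqr ▸ isUpperSet_upperPart hx (hqx b)
    exact q.le_iff_le.2 (hb (q.le_iff_le.1 hx))
  have hplow : IsLowerSet (range p) := hpr ▸ isLowerSet_lowerPart
  have hpq : ∀ a b, p a < q b := fun a b => lt_of_mem_lowerPart_of_mem_upperPart (hpx a) (hqx b)
  by_cases hfin : (lowerPart W).Finite ∧ (upperPart W).Finite
  · obtain ⟨M, _, m, hM, h1, h2, hne, hma, hdiff⟩ := hW.exists_middle hfin.1 hfin.2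
    have hmJ := range_subset_middlePart m
    have hpm : ∀ a b, p a < m b := fun a b =>
      lt_of_mem_lowerPart_of_notMem (hpx a) fun h => hmJ ⟨b, rfl⟩ (Or.inl h)
    have hmq : ∀ a b, m a < q b := fun a b =>
      lt_of_notMem_of_mem_upperPart (fun h => hmJ ⟨a, rfl⟩ (Or.inr h)) (hqx b)
    have hlt : ∀ a b, p a < sumEmbedding m q hmq b := fun a b => by
      obtain ⟨b, rfl⟩ := toLex.surjective b
      rcases b with b | b
      exacts [hpm a b, hpq a b]
    have hPQ : NoMaxOrder P ∧ Nonempty P ∨ NoMinOrder (M ⊕ₗ Q'ᵒᵈ) ∧ Nonempty (M ⊕ₗ Q'ᵒᵈ) :=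
      Or.inr ⟨inferInstance, hne.map fun a => toLex (Sum.inl a)⟩
    have htame : IsTame (sumEmbedding p (sumEmbedding m q hmq) hlt) := by
      refine hpa.isTame_sum (hma.sum hqa hmq (Or.inl h2)) hlt hPQ hplow
        (fun x hx => Or.inl (hmin x hx)) ?_ fun x hx => Or.inr ?_
      · intro b hb
        obtain ⟨b, rfl⟩ := toLex.surjective b
        rcases b with a | b
        · obtain ⟨c, hc⟩ := exists_gt a
          exact ((Sum.Lex.inl_le_inl_iff.1 (hb (Sum.Lex.inl_le_inl_iff.2 hc.le))).not_gt hc).elim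
        · exact hqmax b fun c hc => Sum.Lex.inr_le_inr_iff.1 (hb (Sum.Lex.inr_le_inr_iff.2 hc))
      · rw [range_sumEmbedding]; exact Or.inr (hmax x hx)
    refine htame.hasPrimrecSkeleton hP (hM.sumLex hQ) hPQ fun hf hne => ?_
    have hcompl : (range (sumEmbedding p (sumEmbedding m q hmq) hlt))ᶜ =
        middlePart W \ range m := by
      rw [range_sumEmbedding, range_sumEmbedding, hpr, hqr]
      ext x
      simp only [middlePart, mem_compl_iff, mem_union, mem_sdiff]
      tauto
    rw [hcompl] at hf hne
    exact (hne.ne_empty (hdiff hf)).elim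
  · have hPQ : NoMaxOrder P ∧ Nonempty P ∨ NoMinOrder Q'ᵒᵈ ∧ Nonempty Q'ᵒᵈ :=
      (not_and_or.1 hfin).imp hPinf hQinf'
    refine (hpa.isTame_sum hqa hpq hPQ hplow (fun x hx => Or.inl (hmin x hx)) hqmax
      fun x hx => Or.inr (hmax x hx)).hasPrimrecSkeleton hP hQ hPQ ?_
    rw [range_sumEmbedding, hpr, hqr]
    exact fun h hne => ⟨hPinf (infinite_lowerPart_of_finite_middlePart h hne),
      hQinf' (infinite_upperPart_of_finite_middlePart h hne)⟩

end Skeleton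

/-! ### Computable enumerations with sparse exceptions -/

section Enumeration

theorem primrec_count {p : ℕ → Prop} [DecidablePred p] (hp : PrimrecPred p) :
    Primrec (Nat.count p) := by
  have h : Primrec₂ fun (k c : ℕ) => c + if p k then 1 else 0 :=
    Primrec.nat_add.comp Primrec.snd
      (Primrec.ite (hp.comp Primrec.fst) (Primrec.const 1) (Primrec.const 0))
  refine (Primrec.nat_rec₁ 0 h).of_eq fun n => ?_
  induction n with
  | zero => simp
  | succ n ih => simp [Nat.count_succ, ← ih]

theorem computable_nth {p : ℕ → Prop} (hp : PrimrecPred p) : Computable (Nat.nth p) := by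
  classical
  by_cases hfin : (Set.ofPred p).Finite
  · exact ((Primrec.list_getD 0).comp (Primrec.const hfin.toFinset.sort) Primrec.id).to_comp.of_eq
      fun n => (Nat.nth_eq_getD_sort hfin n).symm
  · have h : ∀ n, ∃ k, p k ∧ Nat.count p k = n := fun n =>
      ⟨Nat.nth p n, Nat.nth_mem_of_infinite hfin n, Nat.count_nth_of_infinite hfin n⟩
    have hdec : PrimrecPred fun x : ℕ × ℕ => p x.2 ∧ Nat.count p x.2 = x.1 :=
      (hp.comp Primrec.snd).and (Primrec.eq.comp ((primrec_count hp).comp Primrec.snd) Primrec.fst)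
    refine (Computable.find (P := fun n k => p k ∧ Nat.count p k = n) hdec.computablePred h).of_eq
      fun n => ?_
    obtain ⟨h1, h2⟩ := Nat.find_spec (h n)
    exact (Nat.nth_count h1).symm.trans (congrArg _ h2)

/-- The points of one subset of `ℕ`, matched in increasing order with those of another subset of
the same size. -/
theorem bijOn_nth_count {p q : ℕ → Prop} [DecidablePred p]
    (h : (Set.ofPred p).encard = (Set.ofPred q).encard) :
    BijOn (fun x => Nat.nth q (Nat.count p x)) (Set.ofPred p) (Set.ofPred q) := by
  classical
  have hcard : ∀ (hp : (Set.ofPred p).Finite) (hq : (Set.ofPred q).Finite),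
      hp.toFinset.card = hq.toFinset.card := fun hp hq => by
    rw [hp.encard_eq_coe_toFinset_card, hq.encard_eq_coe_toFinset_card] at h
    exact_mod_cast h
  have hfin : (Set.ofPred p).Finite ↔ (Set.ofPred q).Finite := by
    rw [← encard_ne_top_iff, h, encard_ne_top_iff]
  have hp : ∀ x, p x → ∀ hq : (Set.ofPred q).Finite, Nat.count p x < hq.toFinset.card :=
    fun x hx hq => hcard (hfin.2 hq) hq ▸ Nat.count_lt_card (hfin.2 hq) hx
  have hq : ∀ x, q x → ∀ hp : (Set.ofPred p).Finite, Nat.count q x < hp.toFinset.card :=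
    fun x hx hp => hcard hp (hfin.1 hp) ▸ Nat.count_lt_card (hfin.1 hp) hx
  refine ⟨fun x hx => Nat.nth_mem _ (hp x hx), fun x hx y hy hxy => ?_, fun y hy => ?_⟩
  · refine Nat.count_injective (p := p) hx hy ?_
    rw [← Nat.count_nth (hp x hx), ← Nat.count_nth (hp y hy)]
    exact congrArg _ hxy
  · refine ⟨Nat.nth p (Nat.count q y), Nat.nth_mem _ (hq y hy), ?_⟩
    simp only [Nat.count_nth (hq y hy), Nat.nth_count (show q y from hy)]

theorem primrecPred_code {E : Type*} [Primcodable E] {S : E → Prop} (hS : PrimrecPred S) :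
    PrimrecPred fun n => ∃ e, S e ∧ Encodable.encode e = n := by
  classical
  refine ⟨inferInstance, ?_⟩
  have h : PrimrecPred fun x : ℕ × E => S x.2 ∧ Encodable.encode x.2 = x.1 :=
    (hS.comp Primrec.snd).and (Primrec.eq.comp (Primrec.encode.comp Primrec.snd) Primrec.fst)
  have h' : Primrec fun n : ℕ => (Option.casesOn (Encodable.decode (α := E) n) false
      fun e => decide (S e ∧ Encodable.encode e = n) : Bool) :=
    Primrec.option_casesOn Primrec.decode (Primrec.const false) h.decide
  refine h'.of_eq fun n => ?_
  cases hd : Encodable.decode (α := E) n with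
  | none =>
    symm
    simp only [decide_eq_false_iff_not, not_exists, not_and]
    rintro e - rfl
    simp at hd
  | some e =>
    refine decide_eq_decide.2 ⟨fun h => ⟨e, h⟩, ?_⟩
    rintro ⟨e', he', rfl⟩
    rw [Encodable.encodek, Option.some_inj] at hd
    exact ⟨hd ▸ he', hd ▸ rfl⟩

/-- A set of squares is so sparse that its complement has density one. -/
theorem hasDensityOne_compl {K : Set ℕ} (hK : ∀ x ∈ K, ∃ i, x = i * i) : HasDensityOne Kᶜ := by
  have hcard : ∀ n : ℕ, (n : ℝ) - Real.sqrt n ≤ ((Kᶜ ∩ Iic n).ncard : ℝ) := by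
    intro n
    have h1 : (K ∩ Iic n).ncard ≤ Nat.sqrt n + 1 := by
      calc (K ∩ Iic n).ncard ≤ ((fun i => i * i) '' Iic (Nat.sqrt n)).ncard := by
            refine ncard_le_ncard ?_ ((finite_Iic _).image _)
            rintro x ⟨hx, hxn⟩
            obtain ⟨i, rfl⟩ := hK x hx
            exact ⟨i, Nat.le_sqrt.2 hxn, rfl⟩
        _ ≤ (Iic (Nat.sqrt n)).ncard := ncard_image_le (finite_Iic _)
        _ = Nat.sqrt n + 1 := by simp [ncard_eq_toFinset_card']
    have h2 : (K ∩ Iic n).ncard + (Kᶜ ∩ Iic n).ncard = n + 1 := by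
      rw [← ncard_union_eq (by
        exact disjoint_compl_right.mono inter_subset_left inter_subset_left)
        ((finite_Iic _).inter_of_right _) ((finite_Iic _).inter_of_right _),
        ← union_inter_distrib_right,
        union_compl_self, univ_inter]
      simp [ncard_eq_toFinset_card']
    have h3 : n ≤ (Kᶜ ∩ Iic n).ncard + Nat.sqrt n := by omega
    have h4 : (Nat.sqrt n : ℝ) ≤ Real.sqrt n := Real.nat_sqrt_le_real_sqrt
    have h5 : (n : ℝ) ≤ (Kᶜ ∩ Iic n).ncard + Nat.sqrt n := by exact_mod_cast h3
    linarith
  have hle : ∀ n : ℕ, (Kᶜ ∩ Iic n).ncard ≤ n + 1 := fun n => by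
    calc (Kᶜ ∩ Iic n).ncard ≤ (Iic n).ncard := ncard_le_ncard inter_subset_right (finite_Iic _)
      _ = n + 1 := by simp [ncard_eq_toFinset_card']
  -- the ratio is squeezed between `1 - 1 / (n + 1) - 1 / √(n + 1)` and `1`
  refine tendsto_of_tendsto_of_tendsto_of_le_of_le
    (g := fun n : ℕ => 1 - 1 / ((n : ℝ) + 1) - Real.sqrt (1 / ((n : ℝ) + 1))) (h := fun _ => 1)
    ?_ tendsto_const_nhds ?_ ?_
  · have h0 := tendsto_one_div_add_atTop_nhds_zero_nat (𝕜 := ℝ)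
    simpa using (h0.const_sub 1).sub ((Real.continuous_sqrt.tendsto _).comp h0)
  · intro n
    have hn : (0 : ℝ) < (n : ℝ) + 1 := by positivity
    have hs : Real.sqrt (1 / ((n : ℝ) + 1)) * ((n : ℝ) + 1) = Real.sqrt ((n : ℝ) + 1) := by
      rw [Real.sqrt_div zero_le_one, Real.sqrt_one]
      nth_rewrite 2 [← Real.mul_self_sqrt hn.le]
      field_simp
    have hs' : Real.sqrt n ≤ Real.sqrt ((n : ℝ) + 1) := Real.sqrt_le_sqrt (by linarith)
    rw [le_div_iff₀ hn, sub_mul, sub_mul, hs]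
    have : 1 / ((n : ℝ) + 1) * ((n : ℝ) + 1) = 1 := by field_simp
    have := hcard n
    linarith
  · intro n
    have hn : (0 : ℝ) < (n : ℝ) + 1 := by positivity
    rw [div_le_one hn]
    exact_mod_cast hle n

/-- A primitive recursive set `E` with an infinite primitive recursive subset `S` has a computable
enumeration without repetitions in which `S` occupies a set of positions of density one. -/
theorem exists_computable_equiv {E : Type*} [Primcodable E] {S : E → Prop} (hS : PrimrecPred S)
    (hinf : (Set.ofPred S).Infinite) :
    ∃ (K : Set ℕ) (T : ℕ ≃ E), Computable T ∧ ComputablePred (fun x => x ∈ Kᶜ) ∧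
      HasDensityOne Kᶜ ∧ ∀ x, S (T x) ↔ x ∈ Kᶜ := by
  classical
  set V : ℕ → Prop := fun n => ∃ e, S e ∧ Encodable.encode e = n with hV
  set V' : ℕ → Prop := fun n => ∃ e, ¬ S e ∧ Encodable.encode e = n with hV'
  have hVp : PrimrecPred V := primrecPred_code hS
  have hVp' : PrimrecPred V' := primrecPred_code hS.not
  have hVinf : (Set.ofPred V).encard = ⊤ := by
    have : Set.ofPred V = Encodable.encode '' Set.ofPred S := rfl
    rw [this, Encodable.encode_injective.encard_image, hinf.encard_eq]
  have hsqrt : PrimrecPred fun x : ℕ => Nat.sqrt x * Nat.sqrt x = x :=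
    Primrec.eq.comp (Primrec.nat_mul.comp Primrec.nat_sqrt Primrec.nat_sqrt) Primrec.id
  have hsq : ∀ s : Set ℕ, Set.ofPred (fun x : ℕ => Nat.sqrt x * Nat.sqrt x = x ∧ Nat.sqrt x ∈ s) =
      (fun i => i * i) '' s := by
    intro s
    ext x
    constructor
    · rintro ⟨h, h'⟩
      exact ⟨_, h', h⟩
    · rintro ⟨i, hi, rfl⟩
      simp [hi]
  have hsqinj : Function.Injective fun i : ℕ => i * i := fun a b h => Nat.mul_self_inj.1 h
  -- the first squares, as many as there are points outside `S`
  obtain ⟨k, hk, hkcard, hksq⟩ : ∃ k : ℕ → Prop, PrimrecPred k ∧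
      (Set.ofPred k).encard = (Set.ofPred V').encard ∧ ∀ x, k x → ∃ i, x = i * i := by
    by_cases hfin : (Set.ofPred V').Finite
    · refine ⟨fun x => Nat.sqrt x * Nat.sqrt x = x ∧ Nat.sqrt x ∈ Iio hfin.toFinset.card,
        hsqrt.and (Primrec.nat_lt.comp Primrec.nat_sqrt (Primrec.const _)), ?_,
        fun x hx => ⟨_, hx.1.symm⟩⟩
      rw [hsq, hsqinj.encard_image, hfin.encard_eq_coe_toFinset_card,
        (finite_Iio _).encard_eq_coe_toFinset_card]
      simp
    · refine ⟨_, hsqrt, ?_, fun x hx => ⟨_, hx.symm⟩⟩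
      have := hsq univ
      simp only [mem_univ, and_true] at this
      rw [this, hsqinj.encard_image, Set.Infinite.encard_eq hfin, infinite_univ.encard_eq]
  have hdens := hasDensityOne_compl (K := Set.ofPred k) hksq
  have hcompl : (Set.ofPred fun x => ¬ k x).encard = (Set.ofPred V).encard := by
    rw [hVinf]
    refine Set.Infinite.encard_eq ((infinite_range_of_injective
      (f := fun i : ℕ => (i + 1) * (i + 1) + 1)
      fun a b h => ?_).mono ?_)
    · have := Nat.mul_self_inj.1 (Nat.succ_injective h)
      omega
    · rintro _ ⟨i, rfl⟩ hi
      obtain ⟨j, hj⟩ := hksq _ hi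
      have hj : (i + 1) * (i + 1) + 1 = j * j := hj
      rcases Nat.lt_or_ge j (i + 2) with h | h
      · have := Nat.mul_le_mul (Nat.lt_succ_iff.1 h) (Nat.lt_succ_iff.1 h)
        omega
      · have := Nat.mul_le_mul h h
        nlinarith
  have hb1 := bijOn_nth_count hkcard
  have hb2 := bijOn_nth_count hcompl
  set T' : ℕ → ℕ := fun x => if k x then Nat.nth V' (Nat.count k x)
    else Nat.nth V (Nat.count (fun x => ¬ k x) x) with hT'
  have hT'c : Computable T' := by
    have h1 : Computable fun x => Nat.nth V' (Nat.count k x) :=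
      (computable_nth hVp').comp (primrec_count hk).to_comp
    have h2 : Computable fun x => Nat.nth V (Nat.count (fun x => ¬ k x) x) :=
      (computable_nth hVp).comp (primrec_count hk.not).to_comp
    refine (Computable.cond hk.decide.to_comp h1 h2).of_eq fun x => ?_
    by_cases h : k x <;> simp [hT', h]
  have hT'k : ∀ x, k x → V' (T' x) := fun x hx => by
    simp only [hT', hx, ↓reduceIte]; exact hb1.mapsTo hx
  have hT'n : ∀ x, ¬ k x → V (T' x) := fun x hx => by
    simp only [hT', hx, ↓reduceIte]; exact hb2.mapsTo hx
  have hdisj : ∀ n, V n → ¬ V' n := by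
    rintro n ⟨e, he, rfl⟩ ⟨e', he', h⟩
    exact he' (Encodable.encode_injective h ▸ he)
  have hex : ∀ x, ∃ e : E, Encodable.encode e = T' x := fun x => by
    by_cases h : k x
    · exact (hT'k x h).imp fun e he => he.2
    · exact (hT'n x h).imp fun e he => he.2
  choose T hT using hex
  have hST : ∀ x, S (T x) ↔ ¬ k x := by
    refine fun x => ⟨fun h hx => hdisj _ ⟨T x, h, hT x⟩ (hT'k x hx), fun h => ?_⟩
    obtain ⟨e, he, he'⟩ := hT'n x h
    rw [← hT, Encodable.encode_inj] at he'
    exact he' ▸ he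
  have hbij : Function.Bijective T := by
    constructor
    · intro x y hxy
      have hxy' : T' x = T' y := by rw [← hT, ← hT, hxy]
      have hiff : k x ↔ k y := by rw [← not_iff_not, ← hST, ← hST, hxy]
      by_cases hx : k x
      · have hy := hiff.1 hx
        simp only [hT', hx, hy, ↓reduceIte] at hxy'
        exact hb1.injOn hx hy hxy'
      · have hy : ¬ k y := fun h => hx (hiff.2 h)
        simp only [hT', hx, hy, ↓reduceIte] at hxy'
        exact hb2.injOn hx hy hxy'
    · intro e
      by_cases he : S e
      · obtain ⟨x, hx, hxe⟩ := hb2.surjOn (show V (Encodable.encode e) from ⟨e, he, rfl⟩)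
        refine ⟨x, Encodable.encode_injective ?_⟩
        rw [hT, ← hxe]
        exact if_neg hx
      · obtain ⟨x, hx, hxe⟩ := hb1.surjOn (show V' (Encodable.encode e) from ⟨e, he, rfl⟩)
        refine ⟨x, Encodable.encode_injective ?_⟩
        rw [hT, ← hxe]
        exact if_pos hx
  exact ⟨Set.ofPred k, Equiv.ofBijective T hbij,
    Computable.encode_iff.1 (hT'c.of_eq fun x => (hT x).symm),
    hk.not.computablePred, hdens, hST⟩

end Enumeration

/-! ### Truth of infinitary formulas -/

section Realization

open FirstOrder.Language

variable {X Y W V : Type*} [LinearOrder W] [LinearOrder V]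

/-- The structure in the language of orders that a map into a linear order induces. -/
abbrev pullbackStructure (e : X → W) : Language.order.Structure X :=
  @orderStructure X ⟨fun x y => e x ≤ e y⟩

theorem realize_qf_iff (e : X ↪ W) (e' : Y ↪ V) {n : ℕ} {v : Fin n → X}
    {v' : Fin n → Y} (h : ∀ i j, e (v i) ≤ e (v j) ↔ e' (v' i) ≤ e' (v' j))
    {φ : Language.order.Formula (Fin n)} (hφ : φ.IsQF) :
    @Formula.Realize _ X (pullbackStructure e) _ φ v ↔
      @Formula.Realize _ Y (pullbackStructure e') _ φ v' := by
  let _ := pullbackStructure (X := X) e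
  let _ := pullbackStructure (X := Y) e'
  have heq : ∀ i j, v i = v j ↔ v' i = v' j := fun i j => by
    rw [← e.injective.eq_iff, ← e'.injective.eq_iff, le_antisymm_iff, le_antisymm_iff, h, h]
  -- the language has no function symbols, so all terms are variables
  have hterm : ∀ t : Language.order.Term (Fin n ⊕ Fin 0), ∃ i, t = Term.var (Sum.inl i) := by
    rintro (⟨i | i⟩ | ⟨f, _⟩)
    · exact ⟨i, rfl⟩
    · exact i.elim0
    · exact isEmptyElim f
  unfold Formula.Realize
  induction hφ with
  | falsum => rfl
  | of_isAtomic ha =>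
    cases ha with
    | equal t₁ t₂ =>
      obtain ⟨i, rfl⟩ := hterm t₁
      obtain ⟨j, rfl⟩ := hterm t₂
      simp [heq i j]
    | rel R ts =>
      cases R
      obtain ⟨i, hi⟩ := hterm (ts 0)
      obtain ⟨j, hj⟩ := hterm (ts 1)
      change e ((ts 0).realize (Sum.elim v default)) ≤ e ((ts 1).realize (Sum.elim v default)) ↔
        e' ((ts 0).realize (Sum.elim v' default)) ≤ e' ((ts 1).realize (Sum.elim v' default))
      rw [hi, hj]
      exact h i j
  | imp _ _ ih1 ih2 => simp only [BoundedFormula.realize_imp, ih1, ih2]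

theorem ordinal_eq_zero_of_lt_of_lt_two {α β : Ordinal} (h : β < α) (hα : α < 2) : β = 0 := by
  have h1 : α ≤ 1 := by
    rw [← Order.lt_add_one_iff, one_add_one_eq_two]; exact hα
  exact Order.lt_one_iff.1 (h.trans_le h1)

theorem InfFormula.IsSigma.realize_iff_of_eq_zero (e : X ↪ W) (e' : Y ↪ V) {n : ℕ}
    {φ : InfFormula Language.order n} {α : Ordinal} (hφ : φ.IsSigma α) (hα : α = 0)
    {v : Fin n → X} {v' : Fin n → Y} (h : ∀ i j, e (v i) ≤ e (v j) ↔ e' (v' i) ≤ e' (v' j)) :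
    φ.Realize (pullbackStructure e) v ↔ φ.Realize (pullbackStructure e') v' := by
  cases hφ with
  | qf φ hφ => exact realize_qf_iff e e' h hφ
  | disj h0 => exact absurd hα h0.ne'

/-- A `Π₁` formula passes from one tuple to another if every finite configuration around the second
tuple is realized around the first one. -/
theorem InfFormula.IsPi.realize_of_lt_two (e : X ↪ W) (e' : Y ↪ V) {n : ℕ}
    {φ : InfFormula Language.order n} {α : Ordinal} (hφ : φ.IsPi α) (hα : α < 2)
    {v : Fin n → X} {v' : Fin n → Y}
    (h : ∀ (m : ℕ) (u' : Fin m → Y), ∃ u : Fin m → X, ∀ i j,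
      e (Fin.append v u i) ≤ e (Fin.append v u j) ↔
        e' (Fin.append v' u' i) ≤ e' (Fin.append v' u' j))
    (hv : φ.Realize (pullbackStructure e) v) : φ.Realize (pullbackStructure e') v' := by
  cases hφ with
  | qf φ hφ =>
    obtain ⟨u, hu⟩ := h 0 Fin.elim0
    refine (realize_qf_iff e e' (fun i j => ?_) hφ).1 hv
    simpa only [Fin.append_left] using hu (Fin.castAdd 0 i) (Fin.castAdd 0 j)
  | conj h0 m φ β hβ hφ =>
    intro i w'
    obtain ⟨w, hw⟩ := h (m i) w'
    exact ((hφ i).realize_iff_of_eq_zero e e' (ordinal_eq_zero_of_lt_of_lt_two (hβ i) hα) hw).1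
      (hv i w)

/-- The back-and-forth criterion for `Σ₂`-elementarity between linear orders. -/
theorem IsTame.isSigmaElementarySubstructure {D : Set X} {f : V ↪o W} (hf : IsTame f)
    (hV : HasLongRuns V) [Nonempty V] (e : X ≃ W) (e' : D ≃ V) (h : ∀ d : D, e d = f (e' d)) :
    IsSigmaElementarySubstructure 2 (pullbackStructure e) D (pullbackStructure e') where
  funMap_eq g := isEmptyElim g
  relMap_iff R v := by
    cases R
    change e' (v 0) ≤ e' (v 1) ↔ e (v 0) ≤ e (v 1)
    rw [h, h, f.le_iff_le]
  realize_iff {n φ} hφ v := by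
    have happ : ∀ {n m : ℕ} (v : Fin n → D) (w : Fin m → D),
        (fun i => ((Fin.append v w i : D) : X)) =
          Fin.append (fun i => (v i : X)) fun i => (w i : X) := by
      intro n m v w
      ext i
      refine Fin.addCases (fun i => ?_) (fun i => ?_) i <;> simp
    generalize hα : (2 : Ordinal) = α at hφ
    cases hφ with
    | qf => simp at hα
    | disj h0 m φ β hβ hφ =>
      subst hα
      constructor
      · rintro ⟨i, w, hw⟩
        refine ⟨i, fun k => w k, ?_⟩
        rw [← happ]
        refine (hφ i).realize_of_lt_two e'.toEmbedding e.toEmbedding (hβ i) (fun l u' => ?_) hw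
        obtain ⟨G, hGa, hG⟩ := hf.exists_retract (fun k => e' (Fin.append v w k))
          (finite_range fun k => e (u' k))
        refine ⟨fun k => e'.symm (G (e (u' k))), ?_⟩
        set p := Fin.append (fun k => ((Fin.append v w k : D) : X)) u' with hp
        have hpm : ∀ k, e (p k) ∈ range (f ∘ fun k => e' (Fin.append v w k)) ∪
            range fun k => e (u' k) := by
          refine Fin.addCases (fun k => Or.inl ⟨k, ?_⟩) fun k => Or.inr ⟨k, ?_⟩ <;> simp [hp, h]
        have hpG : ∀ k, e' (Fin.append (Fin.append v w) (fun k => e'.symm (G (e (u' k)))) k) =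
            G (e (p k)) := by
          refine Fin.addCases (fun k => ?_) fun k => ?_ <;> simp [hp, h, hGa]
        intro j k
        change e' _ ≤ e' _ ↔ e _ ≤ e _
        rw [hpG, hpG, hG.le_iff_le (hpm j) (hpm k)]
      · rintro ⟨i, w, hw⟩
        set b := Fin.append (fun k => (v k : X)) w with hb
        obtain ⟨G, hG, hGf, hback⟩ := hf.exists_back hV fun k => e (b k)
        have hbG : ∀ k, e' (Fin.append v (fun k => e'.symm (G (e (w k)))) k) = G (e (b k)) := by
          refine Fin.addCases (fun k => ?_) fun k => ?_
          · simp only [hb, Fin.append_left, h]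
            refine (hGf _ ⟨Fin.castAdd _ k, ?_⟩).symm
            simp [hb, h]
          · simp [hb]
        refine ⟨i, fun k => e'.symm (G (e (w k))), ?_⟩
        refine (hφ i).realize_of_lt_two e.toEmbedding e'.toEmbedding (hβ i) (fun l u' => ?_) hw
        obtain ⟨H, hHG, hH⟩ := hback _ (finite_range fun k => e' (u' k))
        refine ⟨fun k => e.symm (H (e' (u' k))), ?_⟩
        set p := Fin.append (Fin.append v fun k => e'.symm (G (e (w k)))) u' with hp
        have hpm : ∀ k, e' (p k) ∈ range (G ∘ fun k => e (b k)) ∪ range fun k => e' (u' k) := by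
          refine Fin.addCases (fun k => Or.inl ⟨k, ?_⟩) fun k => Or.inr ⟨k, ?_⟩
          · simp only [hp, Fin.append_left, hbG, Function.comp_apply]
          · simp [hp]
        have hpH : ∀ k, e (Fin.append b (fun k => e.symm (H (e' (u' k)))) k) = H (e' (p k)) := by
          refine Fin.addCases (fun k => ?_) fun k => ?_
          · simp only [hp, Fin.append_left, hbG, hHG]
          · simp [hp]
        intro j k
        change e _ ≤ e _ ↔ e' _ ≤ e' _
        rw [hpH, hpH, hH.le_iff_le (hpm j) (hpm k)]

end Realization

/-! ### Generically and coarsely c.e. copies -/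

section Copies

theorem notMem_range_insertEmbedding {P R Q : Type*} [LinearOrder P] [LinearOrder R]
    [LinearOrder Q] (z : R) :
    (toLex (Sum.inr (toLex (Sum.inl z))) : P ⊕ₗ (R ⊕ₗ Q)) ∉ range (insertEmbedding P R Q) := by
  rintro ⟨s, hs⟩
  obtain ⟨s, rfl⟩ := toLex.surjective s
  rcases s with a | b
  · exact Sum.inl_ne_inr (toLex.injective hs)
  · exact Sum.inr_ne_inl (toLex.injective (Sum.inr_injective (toLex.injective hs)))

theorem primrecPred_range_insertEmbedding {P R Q : Type} [LinearOrder P] [LinearOrder R]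
    [LinearOrder Q] [Primcodable P] [Primcodable R] [Primcodable Q] :
    PrimrecPred fun x : P ⊕ₗ (R ⊕ₗ Q) => x ∈ range (insertEmbedding P R Q) := by
  classical
  have h : Primrec fun x : P ⊕ₗ (R ⊕ₗ Q) => (Sum.casesOn (ofLex x) (fun _ => true)
      fun y => Sum.casesOn (ofLex y) (fun _ => false) fun _ => true : Bool) := by
    refine Primrec.sumCasesOn Primrec.ofLex (Primrec₂.const true) ?_
    exact Primrec.sumCasesOn (Primrec.ofLex.comp Primrec.snd) (Primrec₂.const false)
      (Primrec₂.const true)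
  refine ⟨inferInstance, h.of_eq fun x => ?_⟩
  obtain ⟨x, rfl⟩ := toLex.surjective x
  rcases x with a | x
  · exact (decide_eq_true ⟨toLex (Sum.inl a), rfl⟩).symm
  · obtain ⟨x, rfl⟩ := toLex.surjective x
    rcases x with z | b
    · exact (decide_eq_false (notMem_range_insertEmbedding z)).symm
    · exact (decide_eq_true ⟨toLex (Sum.inr b), rfl⟩).symm

/-- Two orders containing the same suborder, with equally many points outside it, are equinumerous
over it. -/
theorem exists_equiv_over {D E A : Type*} {g : D → E} {f : D → A} (hg : g.Injective)
    (hf : f.Injective) (h : Nonempty (↥(range g)ᶜ ≃ ↥(range f)ᶜ)) :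
    ∃ θ : E ≃ A, ∀ d, θ (g d) = f d := by
  classical
  obtain ⟨h⟩ := h
  refine ⟨(Equiv.Set.sumCompl (range g)).symm.trans ((Equiv.sumCongr
    ((Equiv.ofInjective g hg).symm.trans (Equiv.ofInjective f hf)) h).trans
      (Equiv.Set.sumCompl (range f))), fun d => ?_⟩
  simp [Equiv.Set.sumCompl_symm_apply_of_mem (mem_range_self d)]

theorem nonempty_compl_range_insertEmbedding_equiv (P R Q : Type) [LinearOrder P] [LinearOrder R]
    [LinearOrder Q] : Nonempty (R ≃ ↥(range (insertEmbedding P R Q))ᶜ) := by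
  refine ⟨Equiv.ofBijective (fun z => ⟨toLex (Sum.inr (toLex (Sum.inl z))),
    notMem_range_insertEmbedding z⟩) ⟨?_, ?_⟩⟩
  · intro z w h
    simpa using congrArg Subtype.val h
  · rintro ⟨x, hx⟩
    obtain ⟨z, rfl⟩ := (mem_range_insertEmbedding_or x).resolve_left hx
    exact ⟨z, rfl⟩

/-- An order on `ℕ` is c.e. on a computable set if there it coincides with the order pulled back
along a computable map into a primitive recursive order. -/
theorem isCEOn_of_computable {W E : Type*} [LinearOrder W] [LinearOrder E] [Primcodable E]
    (hE : PrimrecRel fun a b : E => a ≤ b) {e : ℕ → W} {T : ℕ → E} (hT : Computable T) {B : Set ℕ}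
    (hB : ComputablePred fun x => x ∈ B) (h : ∀ x ∈ B, ∀ y ∈ B, e x ≤ e y ↔ T x ≤ T y) :
    IsCEOn (pullbackStructure e) B where
  universe_ce := hB.to_re
  relMap_ce R := by
    classical
    cases R
    have h0 : ∀ i : Fin 2, Computable fun v : Fin 2 → ℕ => v i := fun i =>
      (Primrec.fin_app.comp Primrec.id (Primrec.const i)).to_comp
    have hc : ComputablePred fun v : Fin 2 → ℕ => (v 0 ∈ B ∧ v 1 ∈ B) ∧ T (v 0) ≤ T (v 1) := by
      have h1 : ∀ i : Fin 2, Computable fun v : Fin 2 → ℕ => decide (v i ∈ B) := fun i =>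
        hB.decide.comp (h0 i)
      have h2 : Computable fun v : Fin 2 → ℕ => decide (T (v 0) ≤ T (v 1)) :=
        (hE.decide.to_comp).comp (hT.comp (h0 0)) (hT.comp (h0 1))
      have hand : Computable₂ and := Primrec.and.to_comp
      refine ⟨inferInstance, (hand.comp (hand.comp (h1 0) (h1 1)) h2).of_eq fun v => ?_⟩
      simp [Bool.decide_and]
    refine hc.to_re.of_eq fun v => ?_
    change _ ↔ (∀ i, v i ∈ B) ∧ e (v 0) ≤ e (v 1)
    rw [Fin.forall_fin_two]
    exact and_congr_right fun hv => (h _ hv.1 _ hv.2).symm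
  funMap_ce g := isEmptyElim g

/-- Enumerate `P + R + Q` computably, with `R` on a sparse set of positions. On the remaining
positions this gives a computable copy of `P + Q`; filling the sparse set with the points of `A`
outside `P + Q` instead of `R` gives a copy of `A` that agrees with the computable order on a
computable set of density one. -/
theorem HasPrimrecSkeleton.hasCopies {A : Type*} [LinearOrder A] (hA : IsScattered A)
    (h : HasPrimrecSkeleton A) :
    HasSigmaGenericallyCECopy 2 (linearOrderStructure A) ∧
      HasSigmaCoarselyCECopy 2 (linearOrderStructure A) := by
  obtain ⟨P, R, Q, _, _, _, ⟨_, hP⟩, ⟨_, hR⟩, ⟨_, hQ⟩, hinf, hins, f, hf, ⟨hfR⟩⟩ := h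
  have hruns := (hA.of_embedding f).hasLongRuns
  obtain ⟨hRins⟩ := nonempty_compl_range_insertEmbedding_equiv P R Q
  obtain ⟨θ, hθ⟩ := exists_equiv_over (insertEmbedding P R Q).injective f.injective
    ⟨hRins.symm.trans hfR.symm⟩
  have hE : PrimrecRel fun a b : P ⊕ₗ (R ⊕ₗ Q) => a ≤ b :=
    primrecRel_le_sumLex hP (primrecRel_le_sumLex hR hQ)
  obtain ⟨K, T, hT, hK, hdens, hTK⟩ := exists_computable_equiv
    (primrecPred_range_insertEmbedding (P := P) (R := R) (Q := Q))
    (infinite_range_of_injective (insertEmbedding P R Q).injective)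
  let e' : ↥Kᶜ ≃ P ⊕ₗ Q := (T.subtypeEquiv fun x => (hTK x).symm).trans
    (Equiv.ofInjective _ (insertEmbedding P R Q).injective).symm
  have he' : ∀ d : ↥Kᶜ, T d = insertEmbedding P R Q (e' d) := fun d => by
    have := Equiv.apply_ofInjective_symm (insertEmbedding P R Q).injective
      (T.subtypeEquiv (fun x => (hTK x).symm) d)
    exact this.symm
  have heM : ∀ d : ↥Kᶜ, (T.trans θ) d = f (e' d) := fun d => by
    rw [Equiv.trans_apply, he', hθ]
  have hM := hf.isSigmaElementarySubstructure hruns (T.trans θ) e' heM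
  have hEl := hins.isSigmaElementarySubstructure hruns T e' he'
  have hcopy : letI := linearOrderStructure A
      letI := pullbackStructure (T.trans θ)
      Nonempty (A ≃[FirstOrder.Language.order] ℕ) := by
    let _ := linearOrderStructure A
    let _ := pullbackStructure (T.trans θ)
    refine ⟨⟨(T.trans θ).symm, fun g => isEmptyElim g, fun r x => ?_⟩⟩
    cases r
    change (T.trans θ) ((T.trans θ).symm (x 0)) ≤ (T.trans θ) ((T.trans θ).symm (x 1)) ↔ x 0 ≤ x 1
    simp only [Equiv.apply_symm_apply]
  refine ⟨⟨pullbackStructure (T.trans θ), hcopy, Kᶜ, pullbackStructure e', hdens, ?_, hM⟩,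
    ⟨pullbackStructure (T.trans θ), hcopy, Kᶜ, pullbackStructure e', pullbackStructure T, hdens,
      isCEOn_of_computable hE hT ?_ fun _ _ _ _ => Iff.rfl, hM, hEl⟩⟩
  · refine isCEOn_of_computable hE hT hK fun x hx y hy => ?_
    rw [heM ⟨x, hx⟩, heM ⟨y, hy⟩, f.le_iff_le, he' ⟨x, hx⟩, he' ⟨y, hy⟩,
      (insertEmbedding P R Q).le_iff_le]
  · exact ((Primrec.const true).to_comp.of_eq fun _ => by simp).computablePred

end Copies

theorem theorem3p7 {A : Type*} [LinearOrder A] [Countable A] [Infinite A] (hA : IsScattered A) :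
    HasSigmaGenericallyCECopy 2 (linearOrderStructure A) ∧
      HasSigmaCoarselyCECopy 2 (linearOrderStructure A) :=
  hA.hasPrimrecSkeleton.hasCopies hA
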